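/- Let $\mathsf{RCA}_0^\omega$ be Kohlenbach's base theory of higher-order Reverse Mathematics: classical many-sorted predicate logic over all finite types, with equality $=_0$ of type $0$ as the only primitive predicate (equality at higher types is defined pointwise), constants $0$, $S$, the combinators $\Pi_{\sigma,\tau}$, $\Sigma_{\delta,\rho,\tau}$ and the type-$0$ recursor $R_0$, and as axioms the equality axioms for $=_0$, the successor axioms, the defining equations of the constants, the axioms of extensionality for all finite types, quantifier-free induction, and $\mathsf{QF}\text{-}\mathsf{AC}^{1,0}$: $\forall f^1\exists n^0 A(f,n)\to\exists F^2\forall f^1A(f,F(f))$ for quantifier-free $A$. Let $\mathsf{ACA}_0^\omega$ be $\mathsf{RCA}_0^\omega$ plus $$(\exists^2):\quad \exists\varphi^2\le_2 1\ \forall f^1\,\big[\exists n\,(f(n)=0)\leftrightarrow\varphi(f)=0\big].$$ Let $\mathsf{IND}_0$ be the statement: if $Y$ (mapping $f\in\mathbb N^{\mathbb N}$, $n\in\mathbb N$ to $Y(f,n)\in\mathbb N$) is such that for each $n$ there is at most one $f\in 2^{\mathbb N}$ with $Y(f,n)=0$, then for each $k$ there is a finite sequence $w$ of elements of $\mathbb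 N^{\mathbb N}$ such that for all $m\le k$, $$\exists i<|w|\,\big(w(i)\in 2^{\mathbb N}\wedge Y(w(i),m)=0\big)\leftrightarrow \exists f\in 2^{\mathbb N}\,\big(Y(f,m)=0\big).$$ Real numbers are represented by fast-converging Cauchy sequences of rationals, with the usual defined relations $=_{\mathbb R}$, $\le_{\mathbb R}$, $<_{\mathbb R}$. Functions on $[0,1]$ are functionals that respect $=_{\mathbb R}$ on $[0,1]$. Sets of reals are given by characteristic functions $\mathbb R\to\{0,1\}$. A set $P\subset[0,1]$ is \emph{perfect} if it is non-empty, closed, and has no isolated points. Let $\mathsf{B2}$ be the class of all $g:[0,1]\to\mathbb R$ for which there is a sequence of functions $g_n:[0,1]\to\mathbb R$ with $g(x)=\lim_{n\to\infty}g_n(x)$ for all $x\in[0,1]$, such that for all $n\in\mathbb N$ and all perfect $P\subset[0,1]$ the restriction $g_n{\upharpoonright}P$ has a point of continuity in $P$. Let $\mathsf{HBU}_{\mathsf{B2}}$ be the statement: for every $\Psi:[0,1]\to\mathbb R^+$ in $\mathsf{B2}$ there are $y_0,\dots,y_k\in[0,1]$ with $[0,1]\subset\bigcup_{i\le k}B(y_i,\Psi(y_i))$,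 where $B(y,r)$ is the open interval with centre $y$ and radius $r$. Let $\mathsf{NIN}$ be the statement that there is no injection from $[0,1]$ to $\mathbb N$. Then $\mathsf{ACA}_0^\omega+\mathsf{IND}_0$ proves $\mathsf{HBU}_{\mathsf{B2}}\to\mathsf{NIN}$. -/

import Mathlib

namespace HORM

/-! ## The language of higher-order arithmetic: finite types, terms, formulas -/

/-- Finite types: type `0`, and `σ → τ`. -/
inductive FType : Type
  | nat : FType
  | arr (σ τ : FType) : FType

infixr:60 " ⇒ " => FType.arr

/-- Type `0`. -/
abbrev T0 : FType := FType.nat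

/-- Type `1`, i.e. `0 → 0`. -/
abbrev T1 : FType := T0 ⇒ T0

/-- Type `2`, i.e. `1 → 0`. -/
abbrev T2 : FType := T1 ⇒ T0

/-- Bound variables (well-scoped de Bruijn indices) of type `σ` in a list of binders. -/
inductive Var : List FType → FType → Type
  | here {Γ : List FType} {σ : FType} : Var (σ :: Γ) σ
  | there {Γ : List FType} {σ τ : FType} (v : Var Γ τ) : Var (σ :: Γ) τ

/-- Terms, in the scope of the binders `Γ`.  The free variables are `fvar σ k` (`k : ℕ`), the
constants are zero, successor, the combinators `Π` and `Σ`, and the recursor `R₀`. -/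
inductive Tm (Γ : List FType) : FType → Type
  | bvar {σ : FType} (v : Var Γ σ) : Tm Γ σ
  | fvar (σ : FType) (k : ℕ) : Tm Γ σ
  | zero : Tm Γ T0
  | succ : Tm Γ (T0 ⇒ T0)
  | combPi (σ τ : FType) : Tm Γ (σ ⇒ τ ⇒ σ)
  | combSigma (δ ρ τ : FType) : Tm Γ ((δ ⇒ ρ ⇒ τ) ⇒ (δ ⇒ ρ) ⇒ δ ⇒ τ)
  | recursor : Tm Γ (T0 ⇒ T0 ⇒ (T0 ⇒ T0 ⇒ T0) ⇒ T0)
  | app {σ τ : FType} (f : Tm Γ (σ ⇒ τ)) (a : Tm Γ σ) : Tm Γ τ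

infixl:90 " ⬝ " => Tm.app

/-- Formulas, in the scope of the binders `Γ`.  The only primitive predicate is equality of
objects of type `0`; logic is classical, so that the other connectives are abbreviations. -/
inductive Fm : List FType → Type
  | bot {Γ : List FType} : Fm Γ
  | eq {Γ : List FType} (s t : Tm Γ T0) : Fm Γ
  | imp {Γ : List FType} (φ ψ : Fm Γ) : Fm Γ
  | all {Γ : List FType} {σ : FType} (φ : Fm (σ :: Γ)) : Fm Γ

/-- Simultaneous substitution for the bound variables (terms contain no binders). -/
def Tm.subst {Γ Δ : List FType} (s : ∀ σ, Var Γ σ → Tm Δ σ) : {τ : FType} → Tm Γ τ → Tm Δ τ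
  | _, .bvar v => s _ v
  | _, .fvar σ k => .fvar σ k
  | _, .zero => .zero
  | _, .succ => .succ
  | _, .combPi σ τ => .combPi σ τ
  | _, .combSigma δ ρ τ => .combSigma δ ρ τ
  | _, .recursor => .recursor
  | _, .app f a => .app (f.subst s) (a.subst s)

/-- Weakening by one binder. -/
def Tm.wk {Γ : List FType} {σ τ : FType} (t : Tm Γ τ) : Tm (σ :: Γ) τ :=
  t.subst fun _ v => .bvar (.there v)

/-- A substitution, pushed under one binder. -/
def liftSubst {Γ Δ : List FType} (s : ∀ σ, Var Γ σ → Tm Δ σ) (ρ : FType) :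
    ∀ σ, Var (ρ :: Γ) σ → Tm (ρ :: Δ) σ
  | _, .here => .bvar .here
  | _, .there v => (s _ v).wk

def Fm.subst {Γ Δ : List FType} (s : ∀ σ, Var Γ σ → Tm Δ σ) : Fm Γ → Fm Δ
  | .bot => .bot
  | .eq t u => .eq (t.subst s) (u.subst s)
  | .imp φ ψ => .imp (φ.subst s) (ψ.subst s)
  | .all (σ := σ) φ => .all (φ.subst (liftSubst s σ))

/-- Extend a substitution by a term for the innermost variable. -/
def consSubst {Γ Δ : List FType} {ρ : FType} (t : Tm Δ ρ) (s : ∀ σ, Var Γ σ → Tm Δ σ) :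
    ∀ σ, Var (ρ :: Γ) σ → Tm Δ σ
  | _, .here => t
  | _, .there v => s _ v

/-- `φ(t)`, the instance of `φ` at the term `t` for the innermost variable. -/
def Fm.inst {Γ : List FType} {σ : FType} (φ : Fm (σ :: Γ)) (t : Tm Γ σ) : Fm Γ :=
  φ.subst (consSubst t fun _ v => .bvar v)

/-- The free variable `fvar σ k` occurs in a term. -/
def Tm.Occurs {Γ : List FType} (σ : FType) (k : ℕ) : {τ : FType} → Tm Γ τ → Prop
  | _, .fvar σ' k' => σ' = σ ∧ k' = k
  | _, .app f a => f.Occurs σ k ∨ a.Occurs σ k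
  | _, _ => False

/-- The free variable `fvar σ k` occurs in a formula. -/
def Fm.Occurs (σ : FType) (k : ℕ) : {Γ : List FType} → Fm Γ → Prop
  | _, .bot => False
  | _, .eq s t => s.Occurs σ k ∨ t.Occurs σ k
  | _, .imp φ ψ => φ.Occurs σ k ∨ ψ.Occurs σ k
  | _, .all φ => φ.Occurs σ k

/-- Quantifier-free formulas. -/
def Fm.QF : {Γ : List FType} → Fm Γ → Prop
  | _, .bot => True
  | _, .eq _ _ => True
  | _, .imp φ ψ => φ.QF ∧ ψ.QF
  | _, .all _ => False

section Connectives

variable {Γ : List FType}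

def Fm.neg (φ : Fm Γ) : Fm Γ := .imp φ .bot

def Fm.and (φ ψ : Fm Γ) : Fm Γ := .neg (.imp φ (.neg ψ))

def Fm.iff (φ ψ : Fm Γ) : Fm Γ := .and (.imp φ ψ) (.imp ψ φ)

/-- `∀ x^σ, F x`; terms that come from outside the quantifier are weakened with `wk`. -/
def allQ (σ : FType) (F : Tm (σ :: Γ) σ → Fm (σ :: Γ)) : Fm Γ := .all (F (.bvar .here))

/-- `∃ x^σ, F x`. -/
def exQ (σ : FType) (F : Tm (σ :: Γ) σ → Fm (σ :: Γ)) : Fm Γ :=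
  .neg (allQ σ fun x => .neg (F x))

end Connectives

infixr:40 " ⟶ " => Fm.imp
infixr:50 " ⋀ " => Fm.and
infix:35 " ⟷ " => Fm.iff
infix:55 " ≐ " => Fm.eq

/-! ## Derivability: natural deduction for classical many-sorted predicate logic -/

/-- `Proves T Δ φ`: the formula `φ` is derivable from the finitely many hypotheses `Δ` and the
non-logical axioms `T` (whose free variables are understood as universally quantified). -/
inductive Proves (T : Set (Fm [])) : List (Fm []) → Fm [] → Prop
  | ax {Δ : List (Fm [])} {φ : Fm []} (h : φ ∈ T) : Proves T Δ φ
  | hyp {Δ : List (Fm [])} {φ : Fm []} (h : φ ∈ Δ) : Proves T Δ φ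
  | weaken {Δ Δ' : List (Fm [])} {φ : Fm []} (h : Δ ⊆ Δ') (d : Proves T Δ φ) : Proves T Δ' φ
  | impI {Δ : List (Fm [])} {φ ψ : Fm []} (d : Proves T (φ :: Δ) ψ) : Proves T Δ (φ ⟶ ψ)
  | impE {Δ : List (Fm [])} {φ ψ : Fm []} (d : Proves T Δ (φ ⟶ ψ)) (e : Proves T Δ φ) :
      Proves T Δ ψ
  | raa {Δ : List (Fm [])} {φ : Fm []} (d : Proves T (φ.neg :: Δ) .bot) : Proves T Δ φ
  | allI {Δ : List (Fm [])} {σ : FType} {φ : Fm [σ]} (k : ℕ) (hφ : ¬ φ.Occurs σ k)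
      (hΔ : ∀ ψ ∈ Δ, ¬ ψ.Occurs σ k) (d : Proves T Δ (φ.inst (.fvar σ k))) :
      Proves T Δ (.all φ)
  | allE {Δ : List (Fm [])} {σ : FType} {φ : Fm [σ]} (d : Proves T Δ (.all φ)) (t : Tm [] σ) :
      Proves T Δ (φ.inst t)

/-! ## The base theory -/

/-- Equality at type `σ`: `s x₁ … xₙ = t x₁ … xₙ` at type `0` for all `x₁, …, xₙ`. -/
def eqT : (σ : FType) → {Γ : List FType} → Tm Γ σ → Tm Γ σ → Fm Γ
  | .nat, _, s, t => s ≐ t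
  | .arr σ τ, _, s, t => allQ σ fun x => eqT τ (s.wk ⬝ x) (t.wk ⬝ x)

/-- The axioms of Kohlenbach's base theory `RCA₀^ω`, that is `E-PRA^ω + QF-AC^{1,0}`.  In the two
schemes the parameters are the free variables of the formula `A`. -/
inductive RCA0omega : Fm [] → Prop
  | eq_refl : RCA0omega (allQ T0 fun x => x ≐ x)
  | eq_symm : RCA0omega (allQ T0 fun x => allQ T0 fun y => x.wk ≐ y ⟶ y ≐ x.wk)
  | eq_trans : RCA0omega (allQ T0 fun x => allQ T0 fun y => allQ T0 fun z =>
      x.wk.wk ≐ y.wk ⟶ y.wk ≐ z ⟶ x.wk.wk ≐ z)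
  | succ_ne_zero : RCA0omega (allQ T0 fun x => Fm.neg (.succ ⬝ x ≐ .zero))
  | succ_inj : RCA0omega (allQ T0 fun x => allQ T0 fun y =>
      .succ ⬝ x.wk ≐ .succ ⬝ y ⟶ x.wk ≐ y)
  | combPi (σ τ : FType) : RCA0omega (allQ σ fun x => allQ τ fun y =>
      eqT σ (.combPi σ τ ⬝ x.wk ⬝ y) x.wk)
  | combSigma (δ ρ τ : FType) : RCA0omega (allQ (δ ⇒ ρ ⇒ τ) fun x => allQ (δ ⇒ ρ) fun y =>
      allQ δ fun z => eqT τ (.combSigma δ ρ τ ⬝ x.wk.wk ⬝ y.wk ⬝ z)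
        (x.wk.wk ⬝ z ⬝ (y.wk ⬝ z)))
  | rec_zero : RCA0omega (allQ T0 fun y => allQ (T0 ⇒ T0 ⇒ T0) fun z =>
      .recursor ⬝ .zero ⬝ y.wk ⬝ z ≐ y.wk)
  | rec_succ : RCA0omega (allQ T0 fun x => allQ T0 fun y => allQ (T0 ⇒ T0 ⇒ T0) fun z =>
      .recursor ⬝ (.succ ⬝ x.wk.wk) ⬝ y.wk ⬝ z ≐
        z ⬝ (.recursor ⬝ x.wk.wk ⬝ y.wk ⬝ z) ⬝ x.wk.wk)
  /-- Extensionality `E_{σ,τ}`. -/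
  | ext (σ τ : FType) : RCA0omega (allQ (σ ⇒ τ) fun z => allQ σ fun x => allQ σ fun y =>
      eqT σ x.wk y ⟶ eqT τ (z.wk.wk ⬝ x.wk) (z.wk.wk ⬝ y))
  /-- Quantifier-free induction. -/
  | qfInd (A : Fm [T0]) (hA : A.QF) : RCA0omega
      (A.inst .zero ⟶
        .all (A ⟶ A.subst (consSubst (.succ ⬝ .bvar .here) fun _ v => .bvar (.there v))) ⟶
        .all A)
  /-- `QF-AC^{1,0}`: if `∀ f^1 ∃ n^0 A(f,n)` then `∃ F^2 ∀ f^1 A(f,F(f))`. -/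
  | qfAC (A : Fm [T0, T1]) (hA : A.QF) : RCA0omega
      ((allQ T1 fun _ => .neg (.all A.neg)) ⟶
        exQ T2 fun F => allQ T1 fun f =>
          A.subst (consSubst (F.wk ⬝ f) (consSubst f fun _ v => .bvar (.there (.there v)))))

/-! ## Primitive recursive arithmetic on terms -/

section Arithmetic

variable {Γ : List FType}

/-- Abstraction of the innermost variable, `λ x, t`, defined through the combinators. -/
def Tm.lam {σ : FType} : {τ : FType} → Tm (σ :: Γ) τ → Tm Γ (σ ⇒ τ)
  | _, .bvar .here => .combSigma σ (σ ⇒ σ) σ ⬝ .combPi σ (σ ⇒ σ) ⬝ .combPi σ σ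
  | _, .bvar (.there v) => .combPi _ σ ⬝ .bvar v
  | _, .fvar τ k => .combPi _ σ ⬝ .fvar τ k
  | _, .zero => .combPi _ σ ⬝ .zero
  | _, .succ => .combPi _ σ ⬝ .succ
  | _, .combPi ρ τ => .combPi _ σ ⬝ .combPi ρ τ
  | _, .combSigma δ ρ τ => .combPi _ σ ⬝ .combSigma δ ρ τ
  | _, .recursor => .combPi _ σ ⬝ .recursor
  | _, .app f a => .combSigma _ _ _ ⬝ f.lam ⬝ a.lam

/-- `λ x^σ, F x`. -/
def lamQ (σ : FType) {τ : FType} (F : Tm (σ :: Γ) σ → Tm (σ :: Γ) τ) : Tm Γ (σ ⇒ τ) :=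
  (F (.bvar .here)).lam

/-- Primitive recursion: `g 0 = base`, `g (v + 1) = step (g v) v`, evaluated at `n`. -/
def natRec (n base : Tm Γ T0)
    (step : Tm (T0 :: T0 :: Γ) T0 → Tm (T0 :: T0 :: Γ) T0 → Tm (T0 :: T0 :: Γ) T0) : Tm Γ T0 :=
  .recursor ⬝ n ⬝ base ⬝ lamQ T0 fun u => lamQ T0 fun v => step u.wk v

def sc (t : Tm Γ T0) : Tm Γ T0 := .succ ⬝ t

def one : Tm Γ T0 := sc .zero

def two : Tm Γ T0 := sc one

def add (s t : Tm Γ T0) : Tm Γ T0 := natRec t s fun u _ => sc u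

def mul (s t : Tm Γ T0) : Tm Γ T0 := natRec t .zero fun u _ => add u s.wk.wk

def pow2 (t : Tm Γ T0) : Tm Γ T0 := natRec t one fun u _ => add u u

def pred (t : Tm Γ T0) : Tm Γ T0 := natRec t .zero fun _ v => v

/-- Truncated subtraction. -/
def monus (s t : Tm Γ T0) : Tm Γ T0 := natRec t s fun u _ => pred u

/-- `1` if `s = t`, and `0` otherwise. -/
def eqInd (s t : Tm Γ T0) : Tm Γ T0 := monus one (add (monus s t) (monus t s))

/-- Triangular numbers `0 + 1 + ⋯ + t`. -/
def tri (t : Tm Γ T0) : Tm Γ T0 := natRec t .zero fun u v => add u (sc v)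

/-- The largest `s` with `tri s ≤ t`. -/
def diag (t : Tm Γ T0) : Tm Γ T0 := natRec t .zero fun u v => add u (eqInd (tri (sc u)) (sc v))

/-- Cantor's pairing bijection and its two inverse projections. -/
def pair (s t : Tm Γ T0) : Tm Γ T0 := add (tri (add s t)) s

def fst (p : Tm Γ T0) : Tm Γ T0 := monus p (tri (diag p))

def snd (p : Tm Γ T0) : Tm Γ T0 := monus (diag p) (fst p)

def leN (s t : Tm Γ T0) : Fm Γ := monus s t ≐ .zero

def ltN (s t : Tm Γ T0) : Fm Γ := leN (sc s) t

/-! Rational numbers: the natural number `⟨a, ⟨b, c⟩⟩` codes `(a - b) / (c + 1)`, so that every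
natural number is a code. -/

def mkQ (a b c : Tm Γ T0) : Tm Γ T0 := pair a (pair b c)

/-- Positive part, negative part and denominator of a code. -/
def qPos (q : Tm Γ T0) : Tm Γ T0 := fst q

def qNeg (q : Tm Γ T0) : Tm Γ T0 := fst (snd q)

def qDen (q : Tm Γ T0) : Tm Γ T0 := sc (snd (snd q))

def qLe (p q : Tm Γ T0) : Fm Γ :=
  leN (add (mul (qPos p) (qDen q)) (mul (qNeg q) (qDen p)))
    (add (mul (qPos q) (qDen p)) (mul (qNeg p) (qDen q)))

def qAdd (p q : Tm Γ T0) : Tm Γ T0 :=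
  mkQ (add (mul (qPos p) (qDen q)) (mul (qPos q) (qDen p)))
    (add (mul (qNeg p) (qDen q)) (mul (qNeg q) (qDen p)))
    (pred (mul (qDen p) (qDen q)))

def qSub (p q : Tm Γ T0) : Tm Γ T0 :=
  mkQ (add (mul (qPos p) (qDen q)) (mul (qNeg q) (qDen p)))
    (add (mul (qNeg p) (qDen q)) (mul (qPos q) (qDen p)))
    (pred (mul (qDen p) (qDen q)))

def qAbs (p : Tm Γ T0) : Tm Γ T0 :=
  mkQ (add (monus (qPos p) (qNeg p)) (monus (qNeg p) (qPos p))) .zero (pred (qDen p))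

/-- The rational number `m / 2^k`. -/
def qDyadic (m k : Tm Γ T0) : Tm Γ T0 := mkQ m .zero (pred (pow2 k))

/-! ## Real numbers: fast-converging Cauchy sequences of rationals -/

/-- `x ∈ ℝ`: `|x(k) - x(k+i)| ≤ 2^{-k}` for all `k`, `i`. -/
def isReal (x : Tm Γ T1) : Fm Γ :=
  allQ T0 fun k => allQ T0 fun i =>
    qLe (qAbs (qSub (x.wk.wk ⬝ k.wk) (x.wk.wk ⬝ add k.wk i))) (qDyadic one k.wk)

/-- `x = y` in `ℝ`: `|x(k) - y(k)| ≤ 2^{-k+1}` for all `k`. -/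
def rEq (x y : Tm Γ T1) : Fm Γ :=
  allQ T0 fun k => qLe (qAbs (qSub (x.wk ⬝ k) (y.wk ⬝ k))) (qDyadic two k)

/-- `x ≤ y` in `ℝ`: `x(k) ≤ y(k) + 2^{-k+1}` for all `k`. -/
def rLe (x y : Tm Γ T1) : Fm Γ :=
  allQ T0 fun k => qLe (x.wk ⬝ k) (qAdd (y.wk ⬝ k) (qDyadic two k))

def rLt (x y : Tm Γ T1) : Fm Γ := (rLe y x).neg

/-- A rational number as a real number: the constant sequence. -/
def ofQ (q : Tm Γ T0) : Tm Γ T1 := lamQ T0 fun _ => q.wk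

def rZero : Tm Γ T1 := ofQ (mkQ .zero .zero .zero)

def rOne : Tm Γ T1 := ofQ (mkQ one .zero .zero)

/-- `x - y`, as the sequence `x(k+1) - y(k+1)`. -/
def rSub (x y : Tm Γ T1) : Tm Γ T1 := lamQ T0 fun k => qSub (x.wk ⬝ sc k) (y.wk ⬝ sc k)

def rAbs (x : Tm Γ T1) : Tm Γ T1 := lamQ T0 fun k => qAbs (x.wk ⬝ k)

/-- `|x - y| < r` in `ℝ`. -/
def distLt (x y r : Tm Γ T1) : Fm Γ := rLt (rAbs (rSub x y)) r

/-- `|x - y| < 2^{-k}` in `ℝ`. -/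
def near (x y : Tm Γ T1) (k : Tm Γ T0) : Fm Γ := distLt x y (ofQ (qDyadic one k))

/-- `x ∈ [0,1]`. -/
def inUnit (x : Tm Γ T1) : Fm Γ := isReal x ⋀ rLe rZero x ⋀ rLe x rOne

/-! ## Functions on the unit interval, sets of reals -/

/-- `Y : [0,1] → ℕ`: equal reals have equal values. -/
def isFunUnitNat (Y : Tm Γ T2) : Fm Γ :=
  allQ T1 fun x => allQ T1 fun y => inUnit x.wk ⟶ inUnit y ⟶ rEq x.wk y ⟶
    Y.wk.wk ⬝ x.wk ≐ Y.wk.wk ⬝ y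

/-- `g : [0,1] → ℝ`: the values are reals, and equal reals have equal values. -/
def isFunUnitReal (g : Tm Γ (T1 ⇒ T1)) : Fm Γ :=
  (allQ T1 fun x => inUnit x ⟶ isReal (g.wk ⬝ x)) ⋀
  (allQ T1 fun x => allQ T1 fun y => inUnit x.wk ⟶ inUnit y ⟶ rEq x.wk y ⟶
    rEq (g.wk.wk ⬝ x.wk) (g.wk.wk ⬝ y))

/-- `P : ℝ → {0,1}`, a subset of `ℝ`. -/
def isSet (P : Tm Γ T2) : Fm Γ :=
  (allQ T1 fun x => isReal x ⟶ leN (P.wk ⬝ x) one) ⋀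
  (allQ T1 fun x => allQ T1 fun y => isReal x.wk ⟶ isReal y ⟶ rEq x.wk y ⟶
    P.wk.wk ⬝ x.wk ≐ P.wk.wk ⬝ y)

/-- `x ∈ P` for a real `x`. -/
def mem (x : Tm Γ T1) (P : Tm Γ T2) : Fm Γ := isReal x ⋀ P ⬝ x ≐ one

/-- The set `P` is a perfect subset of `[0,1]`: it is non-empty, closed (each real outside of `P`
has a neighbourhood disjoint from `P`), and without isolated points. -/
def isPerfectInUnit (P : Tm Γ T2) : Fm Γ :=
  isSet P ⋀
  (allQ T1 fun x => mem x P.wk ⟶ inUnit x) ⋀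
  (exQ T1 fun x => mem x P.wk) ⋀
  (allQ T1 fun x => isReal x ⟶ (mem x P.wk).neg ⟶
    exQ T0 fun k => allQ T1 fun y => mem y P.wk.wk.wk ⟶ (near x.wk.wk y k.wk).neg) ⋀
  (allQ T1 fun x => mem x P.wk ⟶ allQ T0 fun k =>
    exQ T1 fun y => mem y P.wk.wk.wk ⋀ (rEq x.wk.wk y).neg ⋀ near x.wk.wk y k.wk)

/-- The restriction of `g` to `P` is continuous at `x`. -/
def continuousOnAt (g : Tm Γ (T1 ⇒ T1)) (P : Tm Γ T2) (x : Tm Γ T1) : Fm Γ :=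
  allQ T0 fun k => exQ T0 fun m => allQ T1 fun y =>
    mem y P.wk.wk.wk ⟶ near x.wk.wk.wk y m.wk ⟶
      near (g.wk.wk.wk ⬝ x.wk.wk.wk) (g.wk.wk.wk ⬝ y) k.wk.wk

/-- The function `g` is the limit of `G 0, G 1, G 2, …` on `[0,1]`. -/
def isLimit (G : Tm Γ (T0 ⇒ T1 ⇒ T1)) (g : Tm Γ (T1 ⇒ T1)) : Fm Γ :=
  allQ T1 fun x => inUnit x ⟶ allQ T0 fun k => exQ T0 fun N => allQ T0 fun n =>
    leN N.wk n ⟶ near (G.wk.wk.wk.wk ⬝ n ⬝ x.wk.wk.wk) (g.wk.wk.wk.wk ⬝ x.wk.wk.wk) k.wk.wk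

/-- The class `B2`: `g : [0,1] → ℝ` is the pointwise limit of a sequence of functions on `[0,1]`
each of which has, when restricted to any perfect `P ⊆ [0,1]`, a point of continuity on `P`. -/
def isB2 (g : Tm Γ (T1 ⇒ T1)) : Fm Γ :=
  isFunUnitReal g ⋀
  exQ (T0 ⇒ T1 ⇒ T1) fun G =>
    (allQ T0 fun n => isFunUnitReal (G.wk ⬝ n)) ⋀
    isLimit G g.wk ⋀
    (allQ T0 fun n => allQ T2 fun P => isPerfectInUnit P ⟶
      exQ T1 fun x => mem x P.wk ⋀ continuousOnAt (G.wk.wk.wk ⬝ n.wk.wk) P.wk x)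

end Arithmetic

/-! ## The principles -/

/-- `∃ φ^2 ≤ 1, ∀ f^1, (∃ n, f(n) = 0) ↔ φ(f) = 0`. -/
def existsTwo : Fm [] :=
  exQ T2 fun φ =>
    (allQ T1 fun f => leN (φ.wk ⬝ f) one) ⋀
    (allQ T1 fun f => (exQ T0 fun n => f.wk ⬝ n ≐ .zero) ⟷ φ.wk ⬝ f ≐ .zero)

/-- `f ∈ 2^ℕ`. -/
def inCantor {Γ : List FType} (f : Tm Γ T1) : Fm Γ := allQ T0 fun n => leN (f.wk ⬝ n) one

/-- If for each `n` there is at most one `f ∈ 2^ℕ` with `Y(f,n) = 0`, then for each `k` there is a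
finite sequence `w` (of length `l`) of objects of type `1` such that for all `m ≤ k`:
`(∃ i < l) (w(i) ∈ 2^ℕ ∧ Y(w(i),m) = 0) ↔ (∃ f ∈ 2^ℕ) Y(f,m) = 0`. -/
def indZero : Fm [] :=
  allQ (T1 ⇒ T0 ⇒ T0) fun Y =>
    (allQ T0 fun n => allQ T1 fun f => allQ T1 fun g =>
      inCantor f.wk ⟶ inCantor g ⟶
      Y.wk.wk.wk ⬝ f.wk ⬝ n.wk.wk ≐ .zero ⟶ Y.wk.wk.wk ⬝ g ⬝ n.wk.wk ≐ .zero ⟶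
      eqT T1 f.wk g) ⟶
    allQ T0 fun k => exQ T0 fun l => exQ (T0 ⇒ T1) fun w => allQ T0 fun m =>
      leN m k.wk.wk.wk ⟶
      ((exQ T0 fun i => ltN i l.wk.wk.wk ⋀ inCantor (w.wk.wk ⬝ i) ⋀
          Y.wk.wk.wk.wk.wk ⬝ (w.wk.wk ⬝ i) ⬝ m.wk ≐ .zero) ⟷
        exQ T1 fun f => inCantor f ⋀ Y.wk.wk.wk.wk.wk ⬝ f ⬝ m.wk ≐ .zero)

/-- There is no injection from `[0,1]` to `ℕ`. -/
def NIN : Fm [] :=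
  Fm.neg <| exQ T2 fun Y =>
    isFunUnitNat Y ⋀
    (allQ T1 fun x => allQ T1 fun y => inUnit x.wk ⟶ inUnit y ⟶
      Y.wk.wk ⬝ x.wk ≐ Y.wk.wk ⬝ y ⟶ rEq x.wk y)

/-- For each `Ψ : [0,1] → ℝ⁺` in `B2` there are `y₀, …, y_k ∈ [0,1]` such that the open intervals
`B(y_i, Ψ(y_i))`, `i ≤ k`, cover `[0,1]`. -/
def HBUB2 : Fm [] :=
  allQ (T1 ⇒ T1) fun Ψ =>
    isB2 Ψ ⟶
    (allQ T1 fun x => inUnit x ⟶ rLt rZero (Ψ.wk ⬝ x)) ⟶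
    exQ T0 fun k => exQ (T0 ⇒ T1) fun y =>
      (allQ T0 fun i => leN i k.wk.wk ⟶ inUnit (y.wk ⬝ i)) ⋀
      (allQ T1 fun x => inUnit x ⟶ exQ T0 fun i =>
        leN i k.wk.wk.wk ⋀
        distLt x.wk (y.wk.wk ⬝ i) (Ψ.wk.wk.wk.wk ⬝ (y.wk.wk ⬝ i)))

/-- `ACA₀^ω + IND₀`, where `ACA₀^ω` is `RCA₀^ω + (∃²)`. -/
def ACA0omegaIND0 : Set (Fm []) :=
  {φ | RCA0omega φ ∨ φ = existsTwo ∨ φ = indZero}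

end HORM

/-!
By a Henkin argument, a formula is derivable as soon as it holds in every extensional model of the
axioms, so one works inside a model `M` with `∃²` and `IND₀`. Let `Y` be an injection of `[0,1]`
into the numbers of `M`. The gauge `Ψ(x) = 4^{-Y(x)-1}` is the pointwise limit of the functions
obtained by truncating `Y` at `n`. Coding reals by elements of Cantor space, `IND₀` lists the
points `x` with `Y(x) ≤ n`; a perfect set contains a point away from this finite list, and near it
the truncation at `n` is constant. Hence `Ψ` is in `B2`. In a finite cover of `[0,1]` by intervals
`B(y_i, Ψ(y_i))` the radii are `4^{-m-1}` with a different `m = Y(y_i)` for different points.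
Starting from `[0,1]`, pass from an interval of length `4^{-m}` to the outer quarter of the half
opposite to the point `y_i` with `Y(y_i) = m`: the real number in these nested intervals has
distance at least `4^{-m-1}` from each such `y_i`, so it is not covered.
-/

namespace HORM

/-! ## The language and its derivations -/

deriving instance Countable for FType, Var, Tm, Fm

section Substitution

variable {Γ Δ Θ : List FType}

theorem Tm.subst_subst (s : ∀ σ, Var Γ σ → Tm Δ σ) (s' : ∀ σ, Var Δ σ → Tm Θ σ) {τ : FType}
    (t : Tm Γ τ) : (t.subst s).subst s' = t.subst fun σ v => (s σ v).subst s' := by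
  induction t <;> simp_all [Tm.subst]

theorem Tm.subst_bvar {τ : FType} (t : Tm Γ τ) : t.subst (fun _ v => .bvar v) = t := by
  induction t <;> simp_all [Tm.subst]

@[simp] theorem Tm.wk_subst_consSubst {σ τ : FType} (t : Tm Γ τ) (u : Tm Δ σ)
    (s : ∀ σ, Var Γ σ → Tm Δ σ) : t.wk.subst (consSubst u s) = t.subst s := by
  simp [Tm.wk, Tm.subst_subst, Tm.subst, consSubst]

@[simp] theorem Tm.wk_subst_liftSubst {σ τ : FType} (t : Tm Γ τ)
    (s : ∀ σ, Var Γ σ → Tm Δ σ) : t.wk.subst (liftSubst s σ) = (t.subst s).wk := by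
  simp [Tm.wk, Tm.subst_subst, Tm.subst, liftSubst]

theorem Fm.subst_subst (φ : Fm Γ) : ∀ {Δ Θ : List FType} (s : ∀ σ, Var Γ σ → Tm Δ σ)
    (s' : ∀ σ, Var Δ σ → Tm Θ σ),
    (φ.subst s).subst s' = φ.subst fun σ v => (s σ v).subst s' := by
  induction φ with
  | bot => intros; rfl
  | eq => intros; simp [Fm.subst, Tm.subst_subst]
  | imp φ ψ ih ih' => intros; simp [Fm.subst, ih, ih']
  | all φ ih =>
    intro Δ Θ s s'
    simp only [Fm.subst, ih]
    congr 2
    funext σ v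
    cases v with
    | here => rfl
    | there v => simp [liftSubst]

theorem Fm.subst_liftSubst_inst {σ : FType} (φ : Fm (σ :: Γ)) (s : ∀ σ, Var Γ σ → Tm Δ σ)
    (u : Tm Δ σ) : (φ.subst (liftSubst s σ)).inst u = φ.subst (consSubst u s) := by
  rw [Fm.inst, Fm.subst_subst]
  congr 1
  funext τ v
  cases v with
  | here => rfl
  | there v => simp [liftSubst, consSubst, Tm.subst_bvar]

theorem liftSubst_bvar (σ : FType) :
    liftSubst (fun _ v => Tm.bvar v : ∀ τ, Var Γ τ → Tm Γ τ) σ = fun _ v => Tm.bvar v := by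
  funext τ v
  cases v <;> rfl

theorem Fm.subst_bvar (φ : Fm Γ) : φ.subst (fun _ v => .bvar v) = φ := by
  induction φ with
  | bot => rfl
  | eq => simp [Fm.subst, Tm.subst_bvar]
  | imp φ ψ ih ih' => simp [Fm.subst, ih, ih']
  | all φ ih => simp [Fm.subst, liftSubst_bvar, ih]

end Substitution

section FreshVariables

open Filter

variable {Γ : List FType}

theorem Tm.eventually_not_occurs {τ : FType} (t : Tm Γ τ) :
    ∀ᶠ k in atTop, ∀ σ, ¬ t.Occurs σ k := by
  induction t with
  | fvar τ j =>
    filter_upwards [eventually_gt_atTop j] with k hk σ ⟨_, h⟩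
    exact hk.ne h
  | app f a ihf iha =>
    filter_upwards [ihf, iha] with k hf ha σ using not_or.2 ⟨hf σ, ha σ⟩
  | _ => exact .of_forall fun _ _ h => h

theorem Fm.eventually_not_occurs (φ : Fm Γ) : ∀ᶠ k in atTop, ∀ σ, ¬ φ.Occurs σ k := by
  induction φ with
  | bot => exact .of_forall fun _ _ h => h
  | eq s t =>
    filter_upwards [s.eventually_not_occurs, t.eventually_not_occurs] with k hs ht σ
      using not_or.2 ⟨hs σ, ht σ⟩
  | imp φ ψ ihφ ihψ =>
    filter_upwards [ihφ, ihψ] with k hφ hψ σ using not_or.2 ⟨hφ σ, hψ σ⟩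
  | all _ ih => exact ih

theorem exists_forall_mem_not_occurs (Δ : List (Fm Γ)) : ∃ k, ∀ φ ∈ Δ, ∀ σ, ¬ φ.Occurs σ k :=
  ((eventually_all_finite (List.finite_toSet Δ)).2 fun φ _ => φ.eventually_not_occurs).exists

end FreshVariables

/-! ## Henkin sets -/

section Henkin

variable {T : Set (Fm [])} {Δ : List (Fm [])} {φ ψ : Fm []}

theorem Proves.cut (d : Proves T Δ φ) (e : Proves T (φ :: Δ) ψ) : Proves T Δ ψ :=
  .impE (.impI e) d

theorem Proves.botE (d : Proves T Δ .bot) : Proves T Δ φ :=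
  .raa (.weaken (List.subset_cons_self _ _) d)

/-- A consistent extension `Δ'` of `Δ` that decides `ψ`, with a witness if `ψ` is a negated
universal formula that it accepts: one step of Henkin's construction. -/
structure IsHenkinExtension (T : Set (Fm [])) (ψ : Fm []) (Δ Δ' : List (Fm [])) : Prop where
  consistent : ¬ Proves T Δ' .bot
  subset : Δ ⊆ Δ'
  mem_or_neg_mem : ψ ∈ Δ' ∨ ψ.neg ∈ Δ'
  exists_witness : ∀ (σ : FType) (χ : Fm [σ]), ψ = (Fm.all χ).neg → ψ ∈ Δ' →
    ∃ t, (χ.inst t).neg ∈ Δ'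

-- A fresh variable serves as the witness.
theorem exists_consistent_witness {σ : FType} {χ : Fm [σ]}
    (h : ¬ Proves T ((Fm.all χ).neg :: Δ) .bot) :
    ∃ t, ¬ Proves T ((χ.inst t).neg :: (Fm.all χ).neg :: Δ) .bot := by
  obtain ⟨k, hk⟩ := exists_forall_mem_not_occurs ((Fm.all χ).neg :: Δ)
  have hχ : ¬ χ.Occurs σ k := fun hχ => hk _ List.mem_cons_self σ (.inl hχ)
  exact ⟨.fvar σ k, fun d => h <| .impE (.hyp List.mem_cons_self) <|
    .allI k hχ (fun θ hθ => hk θ hθ σ) (.raa d)⟩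

theorem exists_isHenkinExtension (hΔ : ¬ Proves T Δ .bot) (ψ : Fm []) :
    ∃ Δ', IsHenkinExtension T ψ Δ Δ' := by
  by_cases h : Proves T (ψ :: Δ) .bot
  · have hn : ¬ Proves T (ψ.neg :: Δ) .bot := fun d => hΔ (Proves.cut (.impI h) d)
    exact ⟨ψ.neg :: Δ, hn, List.subset_cons_self _ _, .inr List.mem_cons_self,
      fun _ _ _ hψ => (hn (.impE (.hyp List.mem_cons_self) (.hyp hψ))).elim⟩
  by_cases hψ : ∃ (σ : FType) (χ : Fm [σ]), ψ = (Fm.all χ).neg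
  · obtain ⟨σ, χ, rfl⟩ := hψ
    obtain ⟨t, ht⟩ := exists_consistent_witness h
    refine ⟨_, ht, List.subset_cons_of_subset _ (List.subset_cons_self _ _),
      .inl (List.mem_cons_of_mem _ List.mem_cons_self), fun σ' χ' e _ => ?_⟩
    simp only [Fm.neg, Fm.imp.injEq, and_true, Fm.all.injEq] at e
    obtain ⟨rfl, e⟩ := e
    exact ⟨t, eq_of_heq e ▸ List.mem_cons_self⟩
  · exact ⟨ψ :: Δ, h, List.subset_cons_self _ _, .inl List.mem_cons_self,
      fun σ χ e => (hψ ⟨σ, χ, e⟩).elim⟩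

/-- Increasing sequences of consistent lists of formulas in which each formula is decided, with a
witness where one is called for, at some stage. -/
structure IsHenkinChain (T : Set (Fm [])) (D : ℕ → List (Fm [])) : Prop where
  consistent : ∀ n, ¬ Proves T (D n) .bot
  monotone : Monotone fun n => {φ | φ ∈ D n}
  exists_extension : ∀ ψ, ∃ n, IsHenkinExtension T ψ (D n) (D (n + 1))

theorem exists_isHenkinChain (hΔ : ¬ Proves T Δ .bot) : ∃ D, IsHenkinChain T D ∧ D 0 = Δ := by
  have : Nonempty (Fm []) := ⟨.bot⟩
  obtain ⟨e, he⟩ := exists_surjective_nat (Fm [])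
  choose next hnext using
    fun (D : {Δ : List (Fm []) // ¬ Proves T Δ .bot}) => exists_isHenkinExtension D.2
  let D : ℕ → {Δ : List (Fm []) // ¬ Proves T Δ .bot} := fun n =>
    Nat.rec ⟨Δ, hΔ⟩ (fun n D => ⟨next D (e n), (hnext D (e n)).consistent⟩) n
  have hD (n : ℕ) : IsHenkinExtension T (e n) (D n).1 (D (n + 1)).1 := hnext (D n) (e n)
  refine ⟨fun n => (D n).1, ⟨fun n => (D n).2, monotone_nat_of_le_succ fun n => (hD n).subset,
    fun ψ => ?_⟩, rfl⟩
  obtain ⟨n, rfl⟩ := he ψ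
  exact ⟨n, hD n⟩

/-- Maximal consistent sets of formulas that contain `T` and have witnesses, described by the
truth conditions for the connectives. -/
structure IsHenkin (T H : Set (Fm [])) : Prop where
  subset : T ⊆ H
  bot_notMem : Fm.bot ∉ H
  imp_mem : ∀ {φ ψ : Fm []}, (φ ⟶ ψ) ∈ H ↔ (φ ∈ H → ψ ∈ H)
  all_mem : ∀ {σ : FType} {φ : Fm [σ]}, Fm.all φ ∈ H ↔ ∀ t, φ.inst t ∈ H

theorem IsHenkinChain.exists_proves_of_imp {D : ℕ → List (Fm [])} (hD : IsHenkinChain T D)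
    (hφψ : ∃ n, Proves T (D n) (φ ⟶ ψ)) (hφ : ∃ n, Proves T (D n) φ) :
    ∃ n, Proves T (D n) ψ := by
  obtain ⟨n, hn⟩ := hφψ
  obtain ⟨m, hm⟩ := hφ
  exact ⟨max n m, .impE (.weaken (hD.monotone (le_max_left n m)) hn)
    (.weaken (hD.monotone (le_max_right n m)) hm)⟩

theorem IsHenkinChain.isHenkin {D : ℕ → List (Fm [])} (hD : IsHenkinChain T D) :
    IsHenkin T {ψ | ∃ n, Proves T (D n) ψ} := by
  have hbot : ¬ ∃ n, Proves T (D n) .bot := fun ⟨n, hn⟩ => hD.consistent n hn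
  refine ⟨fun ψ h => ⟨0, .ax h⟩, hbot, fun {φ ψ} => ?_, fun {σ χ} => ?_⟩
  · refine ⟨hD.exists_proves_of_imp, fun h => ?_⟩
    obtain ⟨n, hn⟩ := hD.exists_extension φ
    rcases hn.mem_or_neg_mem with hφ | hφ
    · obtain ⟨m, hm⟩ := h ⟨n + 1, .hyp hφ⟩
      exact ⟨m, .impI (.weaken (List.subset_cons_self _ _) hm)⟩
    · exact ⟨n + 1, .impI (.botE (.impE (.hyp (List.mem_cons_of_mem _ hφ))
        (.hyp List.mem_cons_self)))⟩
  · refine ⟨fun ⟨n, hn⟩ t => ⟨n, .allE hn t⟩, fun h => ?_⟩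
    obtain ⟨n, hn⟩ := hD.exists_extension (Fm.all χ).neg
    rcases hn.mem_or_neg_mem with hχ | hχ
    · obtain ⟨t, ht⟩ := hn.exists_witness σ χ rfl hχ
      exact (hbot (hD.exists_proves_of_imp ⟨n + 1, .hyp ht⟩ (h t))).elim
    · exact ⟨n + 1, .raa (.impE (.hyp (List.mem_cons_of_mem _ hχ)) (.hyp List.mem_cons_self))⟩

theorem exists_isHenkin (hφ : ¬ Proves T [] φ) : ∃ H, IsHenkin T H ∧ φ ∉ H := by
  obtain ⟨D, hD, hD₀⟩ := exists_isHenkinChain (Δ := [φ.neg]) fun d : Proves T _ _ => hφ (.raa d)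
  have hφD : φ.neg ∈ D 0 := hD₀ ▸ List.mem_cons_self
  exact ⟨_, hD.isHenkin, fun h =>
    hD.isHenkin.bot_notMem (hD.exists_proves_of_imp ⟨0, .hyp hφD⟩ h)⟩

end Henkin

/-! ## Extensional models and completeness -/

/-- Extensional models of the base theory, with the identity as equality at all types.  Injectivity
of the successor is left out: the recursor yields a predecessor.  Of quantifier-free induction only
the case of a disjunction of two equations is needed, which classically is the implication from an
inequation to an equation. -/
structure Model where
  C : FType → Type
  app : ∀ {σ τ : FType}, C (σ ⇒ τ) → C σ → C τ
  zero : C T0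
  succ : C T1
  pi : ∀ σ τ, C (σ ⇒ τ ⇒ σ)
  sigma : ∀ δ ρ τ, C ((δ ⇒ ρ ⇒ τ) ⇒ (δ ⇒ ρ) ⇒ δ ⇒ τ)
  recursor : C (T0 ⇒ T0 ⇒ (T0 ⇒ T0 ⇒ T0) ⇒ T0)
  app_ext : ∀ {σ τ : FType} (f g : C (σ ⇒ τ)), (∀ a, app f a = app g a) → f = g
  pi_app : ∀ {σ τ : FType} (a : C σ) (b : C τ), app (app (pi σ τ) a) b = a
  sigma_app : ∀ {δ ρ τ : FType} (f : C (δ ⇒ ρ ⇒ τ)) (g : C (δ ⇒ ρ)) (a : C δ),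
    app (app (app (sigma δ ρ τ) f) g) a = app (app f a) (app g a)
  recursor_zero : ∀ a f, app (app (app recursor zero) a) f = a
  recursor_succ : ∀ n a f, app (app (app recursor (app succ n)) a) f =
    app (app f (app (app (app recursor n) a) f)) n
  succ_ne_zero : ∀ n, app succ n ≠ zero
  induction : ∀ f g h k : C T1, (app f zero = app g zero ∨ app h zero = app k zero) →
    (∀ n, app f n = app g n ∨ app h n = app k n →
      app f (app succ n) = app g (app succ n) ∨ app h (app succ n) = app k (app succ n)) →
    ∀ n, app f n = app g n ∨ app h n = app k n
  choice : ∀ f : C (T1 ⇒ T0 ⇒ T0), (∀ a, ∃ n, app (app f a) n = zero) →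
    ∃ F : C T2, ∀ a, app (app f a) (app F a) = zero

infixl:90 " ⊙ " => Model.app _

namespace Model

attribute [simp] pi_app sigma_app

variable (M : Model) {Γ Δ : List FType} {σ τ : FType}

/-- Values in `M` for the variables bound in `Γ`. -/
abbrev Env (Γ : List FType) : Type := ∀ σ, Var Γ σ → M.C σ

/-- Values in `M` for the free variables. -/
abbrev Val : Type := ∀ σ : FType, ℕ → M.C σ

/-- The environment without bound variables. -/
def nilEnv : M.Env [] := fun _ v => nomatch v

variable {M}

/-- Extends an environment by a value for the innermost variable. -/
def cons (a : M.C σ) (ρ : M.Env Γ) : M.Env (σ :: Γ)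
  | _, .here => a
  | _, .there v => ρ _ v

/-- The denotation of a term in a model. -/
def eval (ν : M.Val) (ρ : M.Env Γ) : {τ : FType} → Tm Γ τ → M.C τ
  | _, .bvar v => ρ _ v
  | _, .fvar σ k => ν σ k
  | _, .zero => M.zero
  | _, .succ => M.succ
  | _, .combPi σ τ => M.pi σ τ
  | _, .combSigma δ ρ τ => M.sigma δ ρ τ
  | _, .recursor => M.recursor
  | _, .app f a => eval ν ρ f ⊙ eval ν ρ a

/-- Satisfaction of a formula in a model. -/
def Sat (ν : M.Val) : {Γ : List FType} → M.Env Γ → Fm Γ → Prop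
  | _, _, .bot => False
  | _, ρ, .eq s t => eval ν ρ s = eval ν ρ t
  | _, ρ, .imp φ ψ => Sat ν ρ φ → Sat ν ρ ψ
  | _, ρ, .all φ => ∀ a, Sat ν (cons a ρ) φ

variable {ν : M.Val} {ρ : M.Env Γ}

@[simp] theorem sat_eq {s t : Tm Γ T0} : Sat ν ρ (s ≐ t) ↔ eval ν ρ s = eval ν ρ t := Iff.rfl

@[simp] theorem sat_imp {φ ψ : Fm Γ} : Sat ν ρ (φ ⟶ ψ) ↔ (Sat ν ρ φ → Sat ν ρ ψ) := Iff.rfl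

@[simp] theorem sat_neg {φ : Fm Γ} : Sat ν ρ φ.neg ↔ ¬ Sat ν ρ φ := Iff.rfl

@[simp] theorem sat_and {φ ψ : Fm Γ} : Sat ν ρ (φ ⋀ ψ) ↔ Sat ν ρ φ ∧ Sat ν ρ ψ := by
  simp [Fm.and]

@[simp] theorem sat_iff {φ ψ : Fm Γ} : Sat ν ρ (φ ⟷ ψ) ↔ (Sat ν ρ φ ↔ Sat ν ρ ψ) := by
  simp [Fm.iff, iff_def]

@[simp] theorem sat_allQ {F : Tm (σ :: Γ) σ → Fm (σ :: Γ)} :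
    Sat ν ρ (allQ σ F) ↔ ∀ a, Sat ν (cons a ρ) (F (.bvar .here)) := Iff.rfl

@[simp] theorem sat_exQ {F : Tm (σ :: Γ) σ → Fm (σ :: Γ)} :
    Sat ν ρ (exQ σ F) ↔ ∃ a, Sat ν (cons a ρ) (F (.bvar .here)) := by
  simp [exQ]

end Model

section TermModel

variable {Γ Δ : List FType} {H T : Set (Fm [])} {σ τ : FType} {ρ : ∀ σ, Var Γ σ → Tm [] σ}

/-- Equality of closed terms according to the formulas in `H`, pointwise at higher types. -/
def TermEq (H : Set (Fm [])) : (σ : FType) → Tm [] σ → Tm [] σ → Prop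
  | .nat, s, t => (s ≐ t) ∈ H
  | .arr _ τ, s, t => ∀ u, TermEq H τ (s ⬝ u) (t ⬝ u)

/-- The formula `φ` belongs to `H` after substitution of the closed terms `ρ` for its bound
variables: satisfaction in the term model. -/
def Holds (H : Set (Fm [])) (ρ : ∀ σ, Var Γ σ → Tm [] σ) (φ : Fm Γ) : Prop := φ.subst ρ ∈ H

theorem eqT_subst (σ : FType) : ∀ {Γ Δ : List FType} (s t : Tm Γ σ)
    (ρ : ∀ σ, Var Γ σ → Tm Δ σ),
    (eqT σ s t).subst ρ = eqT σ (s.subst ρ) (t.subst ρ) := by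
  induction σ with
  | nat => intros; rfl
  | arr σ τ _ ih =>
    intro Γ Δ s t ρ
    simp [eqT, allQ, Fm.subst, ih, Tm.subst, liftSubst]

theorem holds_nil {ρ : ∀ σ, Var [] σ → Tm [] σ} {φ : Fm []} : Holds H ρ φ ↔ φ ∈ H := by
  have : ρ = fun _ v => .bvar v := by
    funext σ v
    cases v
  rw [Holds, this, Fm.subst_bvar]

theorem holds_eq {s t : Tm Γ T0} :
    Holds H ρ (s ≐ t) ↔ TermEq H .nat (s.subst ρ) (t.subst ρ) := Iff.rfl

namespace IsHenkin

section Satisfaction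

variable (hH : IsHenkin T H)

include hH

theorem not_holds_bot : ¬ Holds H ρ .bot := hH.bot_notMem

theorem holds_imp {φ ψ : Fm Γ} : Holds H ρ (φ ⟶ ψ) ↔ (Holds H ρ φ → Holds H ρ ψ) := hH.imp_mem

theorem holds_neg {φ : Fm Γ} : Holds H ρ φ.neg ↔ ¬ Holds H ρ φ := by
  rw [Fm.neg, hH.holds_imp, imp_iff_not hH.not_holds_bot]

theorem holds_all {φ : Fm (σ :: Γ)} :
    Holds H ρ (.all φ) ↔ ∀ t, Holds H (consSubst t ρ) φ := by
  simp only [Holds, Fm.subst, hH.all_mem, Fm.subst_liftSubst_inst]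

theorem holds_allQ {F : Tm (σ :: Γ) σ → Fm (σ :: Γ)} :
    Holds H ρ (allQ σ F) ↔ ∀ t, Holds H (consSubst t ρ) (F (.bvar .here)) := hH.holds_all

theorem holds_exQ {F : Tm (σ :: Γ) σ → Fm (σ :: Γ)} :
    Holds H ρ (exQ σ F) ↔ ∃ t, Holds H (consSubst t ρ) (F (.bvar .here)) := by
  simp only [exQ, hH.holds_neg, hH.holds_allQ, not_forall, not_not]

theorem eqT_mem_iff (σ : FType) : ∀ s t : Tm [] σ, eqT σ s t ∈ H ↔ TermEq H σ s t := by
  induction σ with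
  | nat => exact fun s t => Iff.rfl
  | arr σ τ _ ih =>
    intro s t
    simp only [eqT, allQ, hH.all_mem, TermEq, ← ih, Fm.inst, eqT_subst, Tm.subst,
      Tm.wk_subst_consSubst, Tm.subst_bvar, consSubst]

theorem holds_eqT {s t : Tm Γ σ} :
    Holds H ρ (eqT σ s t) ↔ TermEq H σ (s.subst ρ) (t.subst ρ) := by
  rw [Holds, eqT_subst, hH.eqT_mem_iff]

end Satisfaction

section Axioms

variable (hH : IsHenkin T H) (hT : {φ | RCA0omega φ} ⊆ T)

include hH hT

theorem holds_of_rca {φ : Fm []} (h : RCA0omega φ) : Holds H (fun _ v => .bvar v) φ :=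
  holds_nil.2 (hH.subset (hT h))

theorem termEq_refl (σ : FType) : ∀ s : Tm [] σ, TermEq H σ s s := by
  induction σ with
  | nat =>
    have := hH.holds_of_rca hT .eq_refl
    simpa only [hH.holds_allQ, holds_eq, Tm.subst, consSubst] using this
  | arr σ τ _ ih => exact fun s u => ih _

theorem termEq_symm (σ : FType) : ∀ {s t : Tm [] σ}, TermEq H σ s t → TermEq H σ t s := by
  induction σ with
  | nat =>
    have := hH.holds_of_rca hT .eq_symm
    simp only [hH.holds_allQ, hH.holds_imp, holds_eq, Tm.subst, consSubst,
      Tm.wk_subst_consSubst] at this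
    exact fun {s t} => this s t
  | arr σ τ _ ih => exact fun h u => ih (h u)

theorem termEq_trans (σ : FType) :
    ∀ {s t u : Tm [] σ}, TermEq H σ s t → TermEq H σ t u → TermEq H σ s u := by
  induction σ with
  | nat =>
    have := hH.holds_of_rca hT .eq_trans
    simp only [hH.holds_allQ, hH.holds_imp, holds_eq, Tm.subst, consSubst,
      Tm.wk_subst_consSubst] at this
    exact fun {s t u} => this s t u
  | arr σ τ _ ih => exact fun h h' u => ih (h u) (h' u)

theorem termEq_app {f g : Tm [] (σ ⇒ τ)} {s t : Tm [] σ}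
    (hfg : TermEq H (σ ⇒ τ) f g) (hst : TermEq H σ s t) : TermEq H τ (f ⬝ s) (g ⬝ t) := by
  refine hH.termEq_trans hT τ (hfg s) ?_
  have := hH.holds_of_rca hT (.ext σ τ)
  simp only [hH.holds_allQ, hH.holds_imp, hH.holds_eqT, Tm.subst, consSubst,
    Tm.wk_subst_consSubst] at this
  exact this g s t hst

theorem termEq_combPi (s : Tm [] σ) (t : Tm [] τ) :
    TermEq H σ (.combPi σ τ ⬝ s ⬝ t) s := by
  have := hH.holds_of_rca hT (.combPi σ τ)
  simp only [hH.holds_allQ, hH.holds_eqT, Tm.subst, consSubst, Tm.wk_subst_consSubst] at this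
  exact this s t

theorem termEq_combSigma {δ : FType} (f : Tm [] (δ ⇒ σ ⇒ τ)) (g : Tm [] (δ ⇒ σ)) (t : Tm [] δ) :
    TermEq H τ (.combSigma δ σ τ ⬝ f ⬝ g ⬝ t) (f ⬝ t ⬝ (g ⬝ t)) := by
  have := hH.holds_of_rca hT (.combSigma δ σ τ)
  simp only [hH.holds_allQ, hH.holds_eqT, Tm.subst, consSubst, Tm.wk_subst_consSubst] at this
  exact this f g t

theorem termEq_recursor_zero (a : Tm [] T0) (f : Tm [] (T0 ⇒ T0 ⇒ T0)) :
    TermEq H T0 (.recursor ⬝ .zero ⬝ a ⬝ f) a := by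
  have := hH.holds_of_rca hT .rec_zero
  simp only [hH.holds_allQ, holds_eq, Tm.subst, consSubst, Tm.wk_subst_consSubst] at this
  exact this a f

theorem termEq_recursor_succ (n a : Tm [] T0) (f : Tm [] (T0 ⇒ T0 ⇒ T0)) :
    TermEq H T0 (.recursor ⬝ (.succ ⬝ n) ⬝ a ⬝ f) (f ⬝ (.recursor ⬝ n ⬝ a ⬝ f) ⬝ n) := by
  have := hH.holds_of_rca hT .rec_succ
  simp only [hH.holds_allQ, holds_eq, Tm.subst, consSubst, Tm.wk_subst_consSubst] at this
  exact this n a f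

theorem not_termEq_succ_zero (n : Tm [] T0) : ¬ TermEq H T0 (.succ ⬝ n) .zero := by
  have := hH.holds_of_rca hT .succ_ne_zero
  simp only [hH.holds_allQ, hH.holds_neg, holds_eq, Tm.subst, consSubst] at this
  exact this n

theorem termEq_induction (f g h k : Tm [] T1)
    (zero : TermEq H T0 (f ⬝ .zero) (g ⬝ .zero) ∨ TermEq H T0 (h ⬝ .zero) (k ⬝ .zero))
    (succ : ∀ n, TermEq H T0 (f ⬝ n) (g ⬝ n) ∨ TermEq H T0 (h ⬝ n) (k ⬝ n) →
      TermEq H T0 (f ⬝ (.succ ⬝ n)) (g ⬝ (.succ ⬝ n)) ∨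
        TermEq H T0 (h ⬝ (.succ ⬝ n)) (k ⬝ (.succ ⬝ n)))
    (n : Tm [] T0) : TermEq H T0 (f ⬝ n) (g ⬝ n) ∨ TermEq H T0 (h ⬝ n) (k ⬝ n) := by
  have hax := hH.holds_of_rca hT (.qfInd (Fm.neg (f.wk ⬝ .bvar .here ≐ g.wk ⬝ .bvar .here) ⟶
    (h.wk ⬝ .bvar .here ≐ k.wk ⬝ .bvar .here)) ⟨⟨trivial, trivial⟩, trivial⟩)
  simp only [hH.holds_imp, hH.holds_all, Fm.inst, Fm.subst, Tm.subst, Tm.wk_subst_consSubst,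
    holds_eq, consSubst, Tm.subst_subst, Tm.subst_bvar, Fm.neg, hH.not_holds_bot, imp_false,
    ← or_iff_not_imp_left] at hax
  exact hax zero succ n

theorem termEq_choice (f : Tm [] (T1 ⇒ T0 ⇒ T0))
    (h : ∀ a, ∃ n, TermEq H T0 (f ⬝ a ⬝ n) .zero) :
    ∃ F : Tm [] T2, ∀ a, TermEq H T0 (f ⬝ a ⬝ (F ⬝ a)) .zero := by
  have hax := hH.holds_of_rca hT
    (.qfAC (f.wk.wk ⬝ .bvar (.there .here) ⬝ .bvar .here ≐ .zero) trivial)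
  simp only [hH.holds_imp, hH.holds_allQ, hH.holds_exQ, hH.holds_all, hH.holds_neg, Fm.subst,
    Tm.subst, Tm.wk_subst_consSubst, holds_eq, consSubst, Tm.subst_subst, Tm.subst_bvar,
    not_forall, not_not] at hax
  exact hax h

end Axioms

variable (hH : IsHenkin T H) (hT : {φ | RCA0omega φ} ⊆ T)

/-- Closed terms up to `TermEq`. -/
def termSetoid (σ : FType) : Setoid (Tm [] σ) where
  r := TermEq H σ
  iseqv := ⟨hH.termEq_refl hT σ, hH.termEq_symm hT σ, hH.termEq_trans hT σ⟩

/-- The model of a Henkin set: closed terms up to `TermEq`. -/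
def termModel : Model where
  C σ := Quotient (hH.termSetoid hT σ)
  app := Quotient.map₂ Tm.app fun _ _ h _ _ h' => hH.termEq_app hT h h'
  zero := ⟦.zero⟧
  succ := ⟦.succ⟧
  pi σ τ := ⟦.combPi σ τ⟧
  sigma δ ρ τ := ⟦.combSigma δ ρ τ⟧
  recursor := ⟦.recursor⟧
  app_ext := by
    rintro σ τ ⟨f⟩ ⟨g⟩ h
    exact Quotient.sound fun u => Quotient.exact (h ⟦u⟧)
  pi_app := by
    rintro σ τ ⟨a⟩ ⟨b⟩
    exact Quotient.sound (hH.termEq_combPi hT a b)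
  sigma_app := by
    rintro δ ρ τ ⟨f⟩ ⟨g⟩ ⟨a⟩
    exact Quotient.sound (hH.termEq_combSigma hT f g a)
  recursor_zero := by
    rintro ⟨a⟩ ⟨f⟩
    exact Quotient.sound (hH.termEq_recursor_zero hT a f)
  recursor_succ := by
    rintro ⟨n⟩ ⟨a⟩ ⟨f⟩
    exact Quotient.sound (hH.termEq_recursor_succ hT n a f)
  succ_ne_zero := by
    rintro ⟨n⟩ h
    exact hH.not_termEq_succ_zero hT n (Quotient.exact h)
  induction := by
    rintro ⟨f⟩ ⟨g⟩ ⟨h⟩ ⟨k⟩ zero succ ⟨n⟩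
    have exact_or {a b c d : Tm [] T0} : ((⟦a⟧ : Quotient (hH.termSetoid hT T0)) = ⟦b⟧ ∨
        (⟦c⟧ : Quotient (hH.termSetoid hT T0)) = ⟦d⟧) ↔ TermEq H T0 a b ∨ TermEq H T0 c d :=
      or_congr Quotient.eq Quotient.eq
    exact exact_or.2 <| hH.termEq_induction hT f g h k (exact_or.1 zero)
      (fun n hn => exact_or.1 (succ ⟦n⟧ (exact_or.2 hn))) n
  choice := by
    rintro ⟨f⟩ h
    have hex (a : Tm [] T1) : ∃ n, TermEq H T0 (f ⬝ a ⬝ n) .zero := by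
      obtain ⟨⟨n⟩, hn⟩ := h ⟦a⟧
      exact ⟨n, Quotient.exact hn⟩
    obtain ⟨F, hF⟩ := hH.termEq_choice hT f hex
    refine ⟨⟦F⟧, ?_⟩
    rintro ⟨a⟩
    exact Quotient.sound (hF a)

/-- The valuation of the term model under which the free variables denote themselves. -/
def termVal : (hH.termModel hT).Val := fun σ k => (⟦.fvar σ k⟧ : Quotient (hH.termSetoid hT σ))

/-- The environment of the term model given by a closed substitution. -/
def termEnv (ρ : ∀ σ, Var Γ σ → Tm [] σ) : (hH.termModel hT).Env Γ :=
  fun σ v => (⟦ρ σ v⟧ : Quotient (hH.termSetoid hT σ))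

theorem eval_termModel (t : Tm Γ τ) :
    Model.eval (hH.termVal hT) (hH.termEnv hT ρ) t =
      (⟦t.subst ρ⟧ : Quotient (hH.termSetoid hT τ)) := by
  induction t with
  | app f a ihf iha =>
    rw [Model.eval, ihf, iha]
    rfl
  | _ => rfl

theorem cons_termEnv (t : Tm [] σ) :
    Model.cons (M := hH.termModel hT) (⟦t⟧ : Quotient (hH.termSetoid hT σ)) (hH.termEnv hT ρ) =
      hH.termEnv hT (consSubst t ρ) := by
  funext τ v
  cases v <;> rfl

theorem sat_termModel_iff (φ : Fm Γ) : ∀ ρ : ∀ σ, Var Γ σ → Tm [] σ,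
    Model.Sat (hH.termVal hT) (hH.termEnv hT ρ) φ ↔ Holds H ρ φ := by
  induction φ with
  | bot => exact fun ρ => iff_of_false id hH.not_holds_bot
  | eq s t =>
    intro ρ
    rw [Model.sat_eq, eval_termModel, eval_termModel, holds_eq]
    exact Quotient.eq
  | imp φ ψ ihφ ihψ =>
    intro ρ
    rw [hH.holds_imp, ← ihφ, ← ihψ, Model.sat_imp]
  | all φ ih =>
    intro ρ
    rw [hH.holds_all]
    refine Quotient.forall.trans (forall_congr' fun t => ?_)
    rw [hH.cons_termEnv hT, ih]

theorem sat_termModel_nilEnv_iff (φ : Fm []) :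
    Model.Sat (hH.termVal hT) (hH.termModel hT).nilEnv φ ↔ φ ∈ H := by
  have hnil : (hH.termModel hT).nilEnv = hH.termEnv hT fun _ v => .bvar v := by
    funext σ v
    cases v
  rw [hnil, sat_termModel_iff, holds_nil]

end IsHenkin

theorem proves_of_forall_sat (hT : {φ | RCA0omega φ} ⊆ T) {φ : Fm []}
    (h : ∀ (M : Model) (ν : M.Val), (∀ ψ ∈ T, Model.Sat ν M.nilEnv ψ) →
      Model.Sat ν M.nilEnv φ) : Proves T [] φ := by
  by_contra hφ
  obtain ⟨H, hH, hφH⟩ := exists_isHenkin hφ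
  exact hφH <| (hH.sat_termModel_nilEnv_iff hT φ).1 <| h _ _ fun ψ hψ =>
    (hH.sat_termModel_nilEnv_iff hT ψ).2 (hH.subset hψ)

end TermModel

namespace Model

/-! ## Definability and evaluation in a model -/

variable {M : Model} {Γ Δ : List FType} {σ τ : FType}

theorem nonempty_C : ∀ σ, Nonempty (M.C σ)
  | .nat => ⟨M.zero⟩
  | .arr σ τ => (nonempty_C τ).map fun a => M.pi τ σ ⊙ a

instance : Nonempty (M.C σ) := nonempty_C σ

/-- Finite products of domains of the model `M` (bracketed to the left, starting from `Pt M`),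
together with the functions that are definable on them by applicative terms with parameters. -/
class Ctx (M : outParam Model) (X : Type) where
  Def : ∀ {τ : FType}, (X → M.C τ) → Prop
  const : ∀ {τ : FType} (c : M.C τ), Def fun _ => c
  app : ∀ {σ τ : FType} {f : X → M.C (σ ⇒ τ)} {g : X → M.C σ}, Def f → Def g →
    Def fun x => f x ⊙ g x

/-- The empty product of domains of `M`. -/
inductive Pt (M : Model) : Type
  | pt

instance : Ctx M M.Pt where
  Def _ := True
  const _ := trivial
  app _ _ := trivial

-- Combinatory completeness: `Π` and `Σ` make it possible to abstract the last variable.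
instance {X : Type} [Ctx M X] : Ctx M (X × M.C σ) where
  Def F := ∃ G, Ctx.Def G ∧ ∀ x y, F (x, y) = G x ⊙ y
  const c := ⟨_, Ctx.const (M.pi _ _ ⊙ c), by simp⟩
  app := fun ⟨G, hG, h⟩ ⟨G', hG', h'⟩ =>
    ⟨_, Ctx.app (Ctx.app (Ctx.const (M.sigma _ _ _)) hG) hG', by simp [h, h']⟩

/-- The function `F` is definable; a class, so that definability is found by instance search. -/
class IsDef {X : Type} [Ctx M X] (F : X → M.C τ) : Prop where
  out : Ctx.Def F

section IsDef

variable {X : Type} [Ctx M X]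

instance IsDef.const (c : M.C τ) : IsDef fun _ : X => c := ⟨Ctx.const c⟩

instance IsDef.app {f : X → M.C (σ ⇒ τ)} {g : X → M.C σ} [hf : IsDef f] [hg : IsDef g] :
    IsDef fun x => f x ⊙ g x := ⟨Ctx.app hf.out hg.out⟩

theorem IsDef.fst {F : X → M.C τ} (h : IsDef F) : IsDef fun p : X × M.C σ => F p.1 :=
  ⟨_, Ctx.app (Ctx.const (M.pi _ _)) h.out, by simp⟩

instance IsDef.snd : IsDef fun p : X × M.C σ => p.2 :=
  ⟨_, Ctx.const (M.sigma _ _ _ ⊙ M.pi σ (σ ⇒ σ) ⊙ M.pi _ _), by simp⟩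

variable {α β γ δ : FType}

instance : IsDef fun p : (X × M.C α) × M.C β => p.1.2 := IsDef.snd.fst
instance : IsDef fun p : ((X × M.C α) × M.C β) × M.C γ => p.1.1.2 := IsDef.snd.fst.fst
instance : IsDef fun p : (((X × M.C α) × M.C β) × M.C γ) × M.C δ => p.1.1.1.2 :=
  IsDef.snd.fst.fst.fst

/-- Abstraction: the object whose values are given by `F`.  It is arbitrary if there is no such
object, but there is one whenever `F` is definable. -/
noncomputable def lam (F : M.C σ → M.C τ) : M.C (σ ⇒ τ) :=
  Classical.epsilon fun e => ∀ x, F x = e ⊙ x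

theorem lam_eq {F : M.C σ → M.C τ} {e : M.C (σ ⇒ τ)} (h : ∀ x, F x = e ⊙ x) : lam F = e :=
  M.app_ext _ _ fun x => by
    rw [← h x, Classical.epsilon_spec (⟨e, h⟩ : ∃ e, ∀ x, F x = e ⊙ x) x, lam]

@[simp] theorem lam_app (F : M.C σ → M.C τ) [h : IsDef fun p : M.Pt × M.C σ => F p.2]
    (x : M.C σ) : lam F ⊙ x = F x := by
  obtain ⟨G, -, h⟩ := h.out
  rw [lam_eq (h .pt), ← h .pt]

instance IsDef.lam {F : X → M.C σ → M.C τ} [h : IsDef fun p : X × M.C σ => F p.1 p.2] :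
    IsDef fun x => lam (F x) := by
  obtain ⟨G, hG, h⟩ := h.out
  have : (fun x => Model.lam (F x)) = G := funext fun x => lam_eq (h x)
  exact ⟨this ▸ hG⟩

end IsDef

section Eval

variable {ν : M.Val} {ρ : M.Env Γ}

@[simp] theorem eval_here {a : M.C σ} : eval ν (cons a ρ) (.bvar .here) = a := rfl

@[simp] theorem eval_there {a : M.C σ} {v : Var Γ τ} :
    eval ν (cons a ρ) (.bvar (.there v)) = eval ν ρ (.bvar v) := rfl

@[simp] theorem eval_app {f : Tm Γ (σ ⇒ τ)} {t : Tm Γ σ} :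
    eval ν ρ (f ⬝ t) = eval ν ρ f ⊙ eval ν ρ t := rfl

@[simp] theorem eval_fvar {k : ℕ} : eval ν ρ (.fvar σ k) = ν σ k := rfl

@[simp] theorem eval_zero : eval ν ρ .zero = M.zero := rfl

@[simp] theorem eval_succ : eval ν ρ .succ = M.succ := rfl

@[simp] theorem eval_combPi : eval ν ρ (.combPi σ τ) = M.pi σ τ := rfl

@[simp] theorem eval_combSigma {δ : FType} :
    eval ν ρ (.combSigma δ σ τ) = M.sigma δ σ τ := rfl

@[simp] theorem eval_recursor : eval ν ρ .recursor = M.recursor := rfl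

theorem eval_subst (s : ∀ σ, Var Γ σ → Tm Δ σ) (ρ : M.Env Δ) (t : Tm Γ τ) :
    eval ν ρ (t.subst s) = eval ν (fun σ v => eval ν ρ (s σ v)) t := by
  induction t with
  | app f a ihf iha => simp [Tm.subst, ihf, iha]
  | _ => rfl

@[simp] theorem eval_wk {a : M.C σ} {t : Tm Γ τ} : eval ν (cons a ρ) t.wk = eval ν ρ t := by
  rw [Tm.wk, eval_subst]
  rfl

theorem eval_lam_app (t : Tm (σ :: Γ) τ) (a : M.C σ) :
    eval ν ρ t.lam ⊙ a = eval ν (cons a ρ) t := by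
  induction t with
  | bvar v => cases v <;> simp [Tm.lam]
  | app f b ihf ihb => simp [Tm.lam, ihf, ihb]
  | _ => simp [Tm.lam]

@[simp] theorem eval_lam {t : Tm (σ :: Γ) τ} :
    eval ν ρ t.lam = lam fun a => eval ν (cons a ρ) t :=
  (lam_eq fun a => (eval_lam_app t a).symm).symm

@[simp] theorem eval_lamQ {F : Tm (σ :: Γ) σ → Tm (σ :: Γ) τ} :
    eval ν ρ (lamQ σ F) = lam fun a => eval ν (cons a ρ) (F (.bvar .here)) := eval_lam

@[simp] theorem sat_eqT : ∀ {σ : FType} {Γ : List FType} {ρ : M.Env Γ} {s t : Tm Γ σ},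
    Sat ν ρ (eqT σ s t) ↔ eval ν ρ s = eval ν ρ t
  | .nat, _, _, _, _ => Iff.rfl
  | .arr σ τ, _, _, _, _ => by
    simp only [eqT, sat_allQ, sat_eqT, eval_app, eval_wk, eval_here]
    exact ⟨M.app_ext _ _, fun h a => by rw [h]⟩

end Eval

variable {X : Type} [Ctx M X]

/-! ## Arithmetic in a model -/

instance : Zero (M.C T0) := ⟨M.zero⟩

@[simp] theorem zero_eq : M.zero = 0 := rfl

/-- The successor of a number of the model; also written `n + 1`, see `S_eq`. -/
def S (n : M.C T0) : M.C T0 := M.succ ⊙ n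

@[simp] theorem succ_app (n : M.C T0) : M.succ ⊙ n = S n := rfl

theorem S_ne_zero (n : M.C T0) : S n ≠ 0 := M.succ_ne_zero n

instance {f : X → M.C T0} [IsDef f] : IsDef fun x => S (f x) := IsDef.app

theorem or_induction {f g h k : M.C T0 → M.C T0} [IsDef fun p : M.Pt × M.C T0 => f p.2]
    [IsDef fun p : M.Pt × M.C T0 => g p.2] [IsDef fun p : M.Pt × M.C T0 => h p.2]
    [IsDef fun p : M.Pt × M.C T0 => k p.2] (zero : f 0 = g 0 ∨ h 0 = k 0)
    (succ : ∀ n, f n = g n ∨ h n = k n → f (S n) = g (S n) ∨ h (S n) = k (S n)) (n : M.C T0) :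
    f n = g n ∨ h n = k n := by
  have := M.induction (lam f) (lam g) (lam h) (lam k)
  simp only [lam_app] at this
  exact this zero succ n

theorem eq_induction {f g : M.C T0 → M.C T0} [IsDef fun p : M.Pt × M.C T0 => f p.2]
    [IsDef fun p : M.Pt × M.C T0 => g p.2] (zero : f 0 = g 0)
    (succ : ∀ n, f n = g n → f (S n) = g (S n)) (n : M.C T0) : f n = g n :=
  or_self_iff.1 (or_induction (.inl zero) (fun n h => .inl (succ n (or_self_iff.1 h))) n)

/-- Primitive recursion: `g 0 = b` and `g (S v) = f (g v) v`, evaluated at `n`. -/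
noncomputable def natrec (n b : M.C T0) (f : M.C T0 → M.C T0 → M.C T0) : M.C T0 :=
  M.recursor ⊙ n ⊙ b ⊙ lam fun u => lam fun v => f u v

section

variable {b : M.C T0} {f : M.C T0 → M.C T0 → M.C T0}

@[simp] theorem natrec_zero : natrec 0 b f = b := M.recursor_zero _ _

@[simp] theorem natrec_S [h : IsDef fun p : (M.Pt × M.C T0) × M.C T0 => f p.1.2 p.2]
    (n : M.C T0) : natrec (S n) b f = f (natrec n b f) n := by
  obtain ⟨G, -, hG⟩ := h.out
  have (u : M.C T0) : IsDef fun p : M.Pt × M.C T0 => f u p.2 :=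
    ⟨_, Ctx.const (G (.pt, u)), fun _ v => hG (.pt, u) v⟩
  refine (M.recursor_succ _ _ _).trans ?_
  rw [lam_app, lam_app]
  rfl

end

instance {n b : X → M.C T0} {f : X → M.C T0 → M.C T0 → M.C T0} [IsDef n] [IsDef b]
    [IsDef fun p : (X × M.C T0) × M.C T0 => f p.1.1 p.1.2 p.2] :
    IsDef fun x => natrec (n x) (b x) (f x) := by
  unfold natrec
  infer_instance

@[simp] theorem eval_natRec {ν : M.Val} {ρ : M.Env Γ} {n b : Tm Γ T0}
    {step : Tm (T0 :: T0 :: Γ) T0 → Tm (T0 :: T0 :: Γ) T0 → Tm (T0 :: T0 :: Γ) T0} :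
    eval ν ρ (natRec n b step) = natrec (eval ν ρ n) (eval ν ρ b) fun u v =>
      eval ν (cons v (cons u ρ)) (step (.bvar (.there .here)) (.bvar .here)) := by
  simp only [natRec, eval_app, eval_lamQ, eval_recursor, natrec]
  rfl

/-- The predecessor, with `pred 0 = 0`. -/
noncomputable def pred (n : M.C T0) : M.C T0 := natrec n 0 fun _ v => v

instance {f : X → M.C T0} [IsDef f] : IsDef fun x => pred (f x) := by
  unfold pred; infer_instance

noncomputable instance : Add (M.C T0) := ⟨fun m n => natrec n m fun u _ => S u⟩

theorem add_def (m n : M.C T0) : m + n = natrec n m fun u _ => S u := rfl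

instance {f g : X → M.C T0} [IsDef f] [IsDef g] : IsDef fun x => f x + g x := by
  simp only [add_def]; infer_instance

noncomputable instance : Mul (M.C T0) := ⟨fun m n => natrec n 0 fun u _ => u + m⟩

theorem mul_def (m n : M.C T0) : m * n = natrec n 0 fun u _ => u + m := rfl

instance {f g : X → M.C T0} [hf : IsDef f] [IsDef g] : IsDef fun x => f x * g x := by
  have := (hf.fst (σ := T0)).fst (σ := T0)
  simp only [mul_def]; infer_instance

noncomputable instance : Sub (M.C T0) := ⟨fun m n => natrec n m fun u _ => pred u⟩

theorem sub_def (m n : M.C T0) : m - n = natrec n m fun u _ => pred u := rfl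

instance {f g : X → M.C T0} [IsDef f] [IsDef g] : IsDef fun x => f x - g x := by
  simp only [sub_def]; infer_instance

instance : One (M.C T0) := ⟨S 0⟩

theorem one_def : (1 : M.C T0) = S 0 := rfl

section Semiring

variable (a b c : M.C T0)

@[simp] theorem pred_zero : pred (0 : M.C T0) = 0 := natrec_zero

@[simp] theorem pred_S : pred (S a) = a := natrec_S _

theorem eq_zero_or_eq_S : a = 0 ∨ ∃ b, a = S b := by
  refine (or_induction (f := fun a => a) (g := fun _ => 0) (h := fun a => a)
    (k := fun a => S (pred a)) (.inl rfl) (fun n _ => .inr ?_) a).imp_right fun h => ⟨_, h⟩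
  rw [pred_S]

protected theorem add_zero : a + 0 = a := natrec_zero

theorem add_S : a + S b = S (a + b) := natrec_S _

protected theorem mul_zero : a * 0 = 0 := natrec_zero

theorem mul_S : a * S b = a * b + a := natrec_S _

protected theorem zero_add : 0 + a = a :=
  eq_induction (f := fun a => 0 + a) (g := fun a => a) (Model.add_zero 0)
    (fun n h => by rw [add_S, h]) a

theorem S_add : S a + b = S (a + b) :=
  eq_induction (f := fun b => S a + b) (g := fun b => S (a + b)) (by simp only [Model.add_zero])
    (fun n h => by simp only [add_S, h]) b

protected theorem add_comm : a + b = b + a :=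
  eq_induction (f := fun b => a + b) (g := fun b => b + a)
    (by simp only [Model.add_zero, Model.zero_add]) (fun n h => by simp only [add_S, S_add, h]) b

protected theorem add_assoc : a + b + c = a + (b + c) :=
  eq_induction (f := fun c => a + b + c) (g := fun c => a + (b + c))
    (by simp only [Model.add_zero]) (fun n h => by simp only [add_S, h]) c

protected theorem zero_mul : 0 * a = 0 :=
  eq_induction (f := fun a => 0 * a) (g := fun _ => 0) (Model.mul_zero 0)
    (fun n h => by simp only [mul_S, h, Model.add_zero]) a

theorem S_mul : S a * b = a * b + b :=
  eq_induction (f := fun b => S a * b) (g := fun b => a * b + b)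
    (by simp only [Model.mul_zero, Model.add_zero])
    (fun n h => by
      simp only [mul_S, h, add_S]
      rw [Model.add_assoc, Model.add_comm n a, ← Model.add_assoc]) b

protected theorem mul_comm : a * b = b * a :=
  eq_induction (f := fun b => a * b) (g := fun b => b * a)
    (by simp only [Model.mul_zero, Model.zero_mul]) (fun n h => by simp only [mul_S, S_mul, h]) b

protected theorem mul_add : a * (b + c) = a * b + a * c :=
  eq_induction (f := fun c => a * (b + c)) (g := fun c => a * b + a * c)
    (by simp only [Model.mul_zero, Model.add_zero])
    (fun n h => by simp only [add_S, mul_S, h, Model.add_assoc]) c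

protected theorem mul_assoc : a * b * c = a * (b * c) :=
  eq_induction (f := fun c => a * b * c) (g := fun c => a * (b * c))
    (by simp only [Model.mul_zero]) (fun n h => by simp only [mul_S, Model.mul_add, h]) c

protected theorem mul_one : a * 1 = a := by
  rw [one_def, mul_S, Model.mul_zero, Model.zero_add]

noncomputable instance : CommSemiring (M.C T0) where
  add_assoc := Model.add_assoc
  zero_add := Model.zero_add
  add_zero := Model.add_zero
  add_comm := Model.add_comm
  left_distrib := Model.mul_add
  right_distrib a b c := by rw [Model.mul_comm, Model.mul_add, Model.mul_comm c, Model.mul_comm c]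
  zero_mul := Model.zero_mul
  mul_zero := Model.mul_zero
  mul_assoc := Model.mul_assoc
  one_mul a := by rw [Model.mul_comm, Model.mul_one]
  mul_one := Model.mul_one
  mul_comm := Model.mul_comm
  nsmul := nsmulRec
  npow := npowRec

theorem S_eq : S a = a + 1 := by rw [one_def, add_S, add_zero]

end Semiring

section Order

variable {a b c : M.C T0}

protected theorem sub_zero (a : M.C T0) : a - 0 = a := natrec_zero

theorem sub_S (a b : M.C T0) : a - S b = pred (a - b) := natrec_S _

theorem S_sub_S (a b : M.C T0) : S a - S b = a - b :=
  eq_induction (f := fun b => S a - S b) (g := fun b => a - b)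
    (by simp only [sub_S, Model.sub_zero, pred_S]) (fun n h => by rw [sub_S, h, sub_S a n]) b

protected theorem zero_sub (a : M.C T0) : 0 - a = 0 :=
  eq_induction (f := fun a => 0 - a) (g := fun _ => 0) (Model.sub_zero _)
    (fun n h => by simp only [sub_S, h, pred_zero]) a

protected theorem add_sub_cancel_left (a b : M.C T0) : a + b - a = b :=
  eq_induction (f := fun a => a + b - a) (g := fun _ => b)
    (by simp only [Model.sub_zero, zero_add]) (fun n h => by simp only [S_add, S_sub_S, h]) a

protected theorem sub_self (a : M.C T0) : a - a = 0 := by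
  simpa only [add_zero] using Model.add_sub_cancel_left a 0

protected theorem sub_add_eq (a b c : M.C T0) : a - (b + c) = a - b - c :=
  eq_induction (f := fun c => a - (b + c)) (g := fun c => a - b - c)
    (by simp only [Model.sub_zero, add_zero]) (fun n h => by simp only [add_S, sub_S, h]) c

theorem eq_add_sub_or (a b : M.C T0) : b = a + (b - a) ∨ a = b + (a - b) := by
  refine or_induction (f := fun _ => b) (g := fun a => a + (b - a)) (h := fun a => a)
    (k := fun a => b + (a - b)) (.inl ?_) (fun a ih => ?_) a
  · simp only [Model.sub_zero, zero_add]
  rcases ih with ih | ih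
  · generalize b - a = c at ih
    subst ih
    rcases eq_zero_or_eq_S c with rfl | ⟨c, rfl⟩
    · right
      rw [add_zero, S_eq, Model.add_sub_cancel_left]
    · left
      rw [add_S, ← S_add, Model.add_sub_cancel_left]
  · generalize a - b = c at ih
    subst ih
    right
    rw [← add_S, Model.add_sub_cancel_left]

instance : LE (M.C T0) := ⟨fun a b => a - b = 0⟩

theorem le_def : a ≤ b ↔ a - b = 0 := Iff.rfl

protected theorem le_iff_exists_add : a ≤ b ↔ ∃ c, b = a + c := by
  constructor
  · intro (h : a - b = 0)
    rcases eq_add_sub_or a b with hb | ha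
    · exact ⟨_, hb⟩
    · exact ⟨0, by rw [ha, h]; simp only [add_zero]⟩
  · rintro ⟨c, rfl⟩
    rw [le_def, Model.sub_add_eq, Model.sub_self, Model.zero_sub]

protected theorem add_left_cancel (h : a + b = a + c) : b = c := by
  rw [← Model.add_sub_cancel_left a b, h, Model.add_sub_cancel_left]

theorem eq_zero_of_add_eq_zero (h : a + b = 0) : a = 0 := by
  rcases eq_zero_or_eq_S a with rfl | ⟨c, rfl⟩
  · rfl
  · rw [S_add] at h
    exact (S_ne_zero _ h).elim

noncomputable instance : LinearOrder (M.C T0) where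
  le_refl a := Model.sub_self a
  le_trans a b c hab hbc := by
    obtain ⟨d, rfl⟩ := Model.le_iff_exists_add.1 hab
    obtain ⟨e, rfl⟩ := Model.le_iff_exists_add.1 hbc
    exact Model.le_iff_exists_add.2 ⟨d + e, add_assoc _ _ _⟩
  le_antisymm a b hab hba := by
    obtain ⟨d, rfl⟩ := Model.le_iff_exists_add.1 hab
    obtain ⟨e, he⟩ := Model.le_iff_exists_add.1 hba
    have hde : d + e = 0 := Model.add_left_cancel (a := a) (by rw [← add_assoc, ← he, add_zero])
    rw [eq_zero_of_add_eq_zero hde, add_zero]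
  le_total a b := (eq_add_sub_or a b).imp (fun h => Model.le_iff_exists_add.2 ⟨_, h⟩)
    fun h => Model.le_iff_exists_add.2 ⟨_, h⟩
  toDecidableLE := Classical.decRel _

instance : IsOrderedCancelAddMonoid (M.C T0) where
  add_le_add_left a b h c := by
    obtain ⟨d, rfl⟩ := Model.le_iff_exists_add.1 h
    exact Model.le_iff_exists_add.2 ⟨d, add_right_comm a d c⟩
  le_of_add_le_add_left a b c h := by
    obtain ⟨d, hd⟩ := Model.le_iff_exists_add.1 h
    exact Model.le_iff_exists_add.2 ⟨d, Model.add_left_cancel (hd.trans (add_assoc a b d))⟩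

instance : CanonicallyOrderedAdd (M.C T0) where
  exists_add_of_le h := Model.le_iff_exists_add.1 h
  le_add_self _ b := Model.le_iff_exists_add.2 ⟨b, add_comm _ _⟩
  le_self_add _ b := Model.le_iff_exists_add.2 ⟨b, rfl⟩

instance : Nontrivial (M.C T0) := ⟨⟨1, 0, S_ne_zero 0⟩⟩

instance : NoZeroDivisors (M.C T0) where
  eq_zero_or_eq_zero_of_mul_eq_zero {a b} h := by
    rcases eq_zero_or_eq_S a with rfl | ⟨a, rfl⟩
    · exact .inl rfl
    rcases eq_zero_or_eq_S b with rfl | ⟨b, rfl⟩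
    · exact .inr rfl
    rw [mul_S, add_S] at h
    exact (S_ne_zero _ h).elim

instance : OrderedSub (M.C T0) where
  tsub_le_iff_right a b c := by rw [le_def, le_def, ← Model.sub_add_eq, add_comm]

instance : IsStrictOrderedRing (M.C T0) where
  zero_le_one := zero_le
  mul_lt_mul_of_pos_left a ha b c h := by
    obtain ⟨d, hd, rfl⟩ := lt_iff_exists_add.1 h
    rw [mul_add]
    exact lt_add_of_pos_right _ (CanonicallyOrderedAdd.mul_pos.2 ⟨ha, hd⟩)
  mul_lt_mul_of_pos_right a ha b c h := by
    obtain ⟨d, hd, rfl⟩ := lt_iff_exists_add.1 h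
    rw [add_mul]
    exact lt_add_of_pos_right _ (CanonicallyOrderedAdd.mul_pos.2 ⟨hd, ha⟩)

noncomputable instance : SuccOrder (M.C T0) := .ofSuccLeIff (· + 1) fun {a b} => by
  refine ⟨fun h => (lt_add_one a).trans_le h, fun h => ?_⟩
  obtain ⟨d, hd, rfl⟩ := lt_iff_exists_add.1 h
  obtain ⟨d, rfl⟩ := (eq_zero_or_eq_S d).resolve_left hd.ne'
  rw [S_eq]
  exact add_le_add_right le_add_self a

noncomputable instance : SuccAddOrder (M.C T0) := ⟨fun _ => rfl⟩

end Order

section EvalArithmetic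

variable {ν : M.Val} {ρ : M.Env Γ} {s t : Tm Γ T0}

@[simp] theorem eval_sc : eval ν ρ (sc t) = eval ν ρ t + 1 := S_eq _

@[simp] theorem eval_one : eval ν ρ one = 1 := rfl

@[simp] theorem eval_two : eval ν ρ two = 2 := by
  simp only [two, eval_sc, eval_one, one_add_one_eq_two]

@[simp] theorem eval_add : eval ν ρ (add s t) = eval ν ρ s + eval ν ρ t := by
  simp [add, add_def, sc]

@[simp] theorem eval_pred : eval ν ρ (HORM.pred t) = pred (eval ν ρ t) := by
  simp [HORM.pred, pred]

@[simp] theorem eval_mul : eval ν ρ (mul s t) = eval ν ρ s * eval ν ρ t := by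
  simp [mul, mul_def]

@[simp] theorem eval_monus : eval ν ρ (monus s t) = eval ν ρ s - eval ν ρ t := by
  simp [monus, sub_def]

@[simp] theorem sat_leN : Sat ν ρ (leN s t) ↔ eval ν ρ s ≤ eval ν ρ t := by
  simp [leN, le_def]

@[simp] theorem sat_ltN : Sat ν ρ (ltN s t) ↔ eval ν ρ s < eval ν ρ t := by
  simp [ltN]

end EvalArithmetic

theorem pred_add_one_of_pos {n : M.C T0} (h : 0 < n) : pred n + 1 = n := by
  obtain ⟨m, rfl⟩ := (eq_zero_or_eq_S n).resolve_left h.ne'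
  rw [pred_S, S_eq]

@[simp] theorem natrec_add_one {b : M.C T0} {f : M.C T0 → M.C T0 → M.C T0}
    [IsDef fun p : (M.Pt × M.C T0) × M.C T0 => f p.1.2 p.2] (n : M.C T0) :
    natrec (n + 1) b f = f (natrec n b f) n := by
  rw [← S_eq, natrec_S]

/-! ## Definable predicates and searching -/

/-- The predicate `P` has a definable characteristic function, with `0` for truth. -/
class IsDefP (P : X → Prop) : Prop where
  out : ∃ f : X → M.C T0, IsDef f ∧ ∀ x, P x ↔ f x = 0

theorem IsDefP.of_iff {P : X → Prop} (f : X → M.C T0) [IsDef f] (h : ∀ x, P x ↔ f x = 0) :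
    IsDefP P := ⟨f, inferInstance, h⟩

theorem IsDefP.congr {P Q : X → Prop} (h : IsDefP P) (hPQ : ∀ x, Q x ↔ P x) : IsDefP Q := by
  rwa [show Q = P from funext fun x => propext (hPQ x)]

theorem one_sub_eq_zero_iff {n : M.C T0} : 1 - n = 0 ↔ n ≠ 0 := by
  rw [← le_def, Order.one_le_iff_ne_zero]

instance (p : Prop) : IsDefP fun _ : X => p := by
  by_cases h : p
  · exact .of_iff (fun _ => 0) fun _ => iff_of_true h rfl
  · exact .of_iff (fun _ => 1) fun _ => iff_of_false h one_ne_zero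

instance {f g : X → M.C T0} [IsDef f] [IsDef g] : IsDefP fun x => f x ≤ g x :=
  .of_iff (fun x => f x - g x) fun _ => Iff.rfl

instance {P : X → Prop} [h : IsDefP P] : IsDefP fun x => ¬ P x := by
  obtain ⟨f, hf, h⟩ := h.out
  exact .of_iff (fun x => 1 - f x) fun x => by rw [h, one_sub_eq_zero_iff]

instance {P Q : X → Prop} [hP : IsDefP P] [hQ : IsDefP Q] : IsDefP fun x => P x ∧ Q x := by
  obtain ⟨f, hf, hP⟩ := hP.out
  obtain ⟨g, hg, hQ⟩ := hQ.out
  exact .of_iff (fun x => f x + g x) fun x => by rw [hP, hQ, add_eq_zero]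

instance {P Q : X → Prop} [IsDefP P] [IsDefP Q] : IsDefP fun x => P x → Q x :=
  (inferInstance : IsDefP fun x => ¬ (P x ∧ ¬ Q x)).congr fun x => by tauto

instance {f g : X → M.C T0} [IsDef f] [IsDef g] : IsDefP fun x => f x < g x :=
  (inferInstance : IsDefP fun x => ¬ (g x ≤ f x)).congr fun _ => not_le.symm

instance {f g : X → M.C T0} [IsDef f] [IsDef g] : IsDefP fun x => f x = g x :=
  (inferInstance : IsDefP fun x => f x ≤ g x ∧ g x ≤ f x).congr fun _ => le_antisymm_iff

instance {P : X → Prop} [h : IsDefP P] [∀ x, Decidable (P x)] {f g : X → M.C T0} [IsDef f]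
    [IsDef g] : IsDef fun x => if P x then f x else g x := by
  obtain ⟨c, hc, h⟩ := h.out
  have ite_eq : (fun x => if P x then f x else g x) =
      fun x => (1 - c x) * f x + (1 - (1 - c x)) * g x := by
    funext x
    by_cases hx : P x
    · simp [hx, (h x).1 hx]
    · simp [hx, one_sub_eq_zero_iff.2 (mt (h x).2 hx)]
  rw [ite_eq]
  infer_instance

theorem definable_induction {P : M.C T0 → Prop}
    (definable : IsDefP fun p : M.Pt × M.C T0 => P p.2)
    (zero : P 0) (succ : ∀ n, P n → P (n + 1)) (n : M.C T0) : P n := by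
  obtain ⟨f, hf, h⟩ := definable.out
  have hP (n : M.C T0) : P n ↔ f (.pt, n) = 0 := h (.pt, n)
  obtain ⟨G, -, hG⟩ := hf.out
  have : IsDef fun p : M.Pt × M.C T0 => f (.pt, p.2) := ⟨_, Ctx.const (G .pt), fun _ y => hG _ y⟩
  refine (hP n).2 (eq_induction (f := fun n => f (.pt, n)) (g := fun _ => 0) ((hP 0).1 zero)
    (fun n hn => ?_) n)
  rw [S_eq]
  exact (hP _).1 (succ n ((hP n).2 hn))

/-- The model `M` has a functional `∃²`, deciding whether `f` has a zero. -/
class HasE2 (M : Model) : Prop where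
  out : ∃ φ : M.C T2, ∀ f : M.C T1, (∃ n, f ⊙ n = 0) ↔ φ ⊙ f = 0

/-- The functional `F` finds a zero of each function that has one: Feferman's search operator. -/
def IsSearch (F : M.C T2) : Prop :=
  ∀ f : M.C T1, (∃ n, f ⊙ n = 0) → f ⊙ (F ⊙ f) = 0

section HasE2

variable [HasE2 M]

instance {P : X → M.C T0 → Prop} [h : IsDefP fun p : X × M.C T0 => P p.1 p.2] :
    IsDefP fun x => ∃ n, P x n := by
  obtain ⟨f, hf, h⟩ := h.out
  obtain ⟨φ, hφ⟩ := HasE2.out (M := M)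
  obtain ⟨G, hG, hfG⟩ := hf.out
  have : IsDef G := ⟨hG⟩
  refine .of_iff (fun x => φ ⊙ G x) fun x => ?_
  rw [← hφ]
  exact exists_congr fun n => (h (x, n)).trans (by rw [hfG])

instance {P : X → M.C T0 → Prop} [IsDefP fun p : X × M.C T0 => P p.1 p.2] :
    IsDefP fun x => ∀ n, P x n :=
  (inferInstance : IsDefP fun x => ¬ ∃ n, ¬ P x n).congr fun x => by simp

-- Apply `QF-AC^{1,0}` to the total relation `(∃ m, f ⊙ m = 0) → f ⊙ n = 0`.
theorem exists_isSearch : ∃ F : M.C T2, IsSearch F := by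
  classical
  let A : M.C (T1 ⇒ T0 ⇒ T0) :=
    lam fun f => lam fun n => if ∃ m, f ⊙ m = 0 then f ⊙ n else 0
  have hA (f n) : A ⊙ f ⊙ n = if ∃ m, f ⊙ m = 0 then f ⊙ n else 0 := by
    simp only [A, lam_app]
  have A_total (f) : ∃ n, A ⊙ f ⊙ n = 0 := by
    by_cases h : ∃ m, f ⊙ m = 0
    · obtain ⟨n, hn⟩ := h
      exact ⟨n, by rw [hA, hn, ite_self]⟩
    · exact ⟨0, by rw [hA, if_neg h]⟩
  obtain ⟨F, hF⟩ := M.choice A A_total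
  refine ⟨F, fun f hf => ?_⟩
  simpa only [hA, if_pos hf, zero_eq] using hF f

end HasE2

/-! ## Pairing and powers of two -/

/-- Triangular numbers `0 + 1 + ⋯ + n`. -/
noncomputable def tri (n : M.C T0) : M.C T0 := natrec n 0 fun u v => u + (v + 1)

/-- `1` if `m = n`, and `0` otherwise. -/
noncomputable def eqInd (m n : M.C T0) : M.C T0 := 1 - ((m - n) + (n - m))

instance {f : X → M.C T0} [IsDef f] : IsDef fun x => tri (f x) := by
  unfold tri; infer_instance

instance {f g : X → M.C T0} [IsDef f] [IsDef g] : IsDef fun x => eqInd (f x) (g x) := by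
  unfold eqInd; infer_instance

/-- The largest `m` with `tri m ≤ n`. -/
noncomputable def diag (n : M.C T0) : M.C T0 :=
  natrec n 0 fun u v => u + eqInd (tri (u + 1)) (v + 1)

instance {f : X → M.C T0} [IsDef f] : IsDef fun x => diag (f x) := by
  unfold diag; infer_instance

/-- Cantor's pairing function. -/
noncomputable def pair (m n : M.C T0) : M.C T0 := tri (m + n) + m

instance {f g : X → M.C T0} [IsDef f] [IsDef g] : IsDef fun x => pair (f x) (g x) := by
  unfold pair; infer_instance

/-- The first component of a pair. -/
noncomputable def fst (n : M.C T0) : M.C T0 := n - tri (diag n)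

instance {f : X → M.C T0} [IsDef f] : IsDef fun x => fst (f x) := by
  unfold fst; infer_instance

/-- The second component of a pair. -/
noncomputable def snd (n : M.C T0) : M.C T0 := diag n - fst n

instance {f : X → M.C T0} [IsDef f] : IsDef fun x => snd (f x) := by
  unfold snd; infer_instance

/-- Powers of two. -/
noncomputable def pow2 (n : M.C T0) : M.C T0 := natrec n 1 fun u _ => u + u

instance {f : X → M.C T0} [IsDef f] : IsDef fun x => pow2 (f x) := by
  unfold pow2; infer_instance

@[simp] theorem tri_zero : tri (0 : M.C T0) = 0 := natrec_zero

@[simp] theorem tri_add_one (n : M.C T0) : tri (n + 1) = tri n + (n + 1) := natrec_add_one n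

theorem eqInd_self (n : M.C T0) : eqInd n n = 1 := by simp [eqInd]

theorem eqInd_of_ne {m n : M.C T0} (h : m ≠ n) : eqInd m n = 0 := by
  rw [eqInd, one_sub_eq_zero_iff, ne_eq, add_eq_zero]
  exact fun h' => h (le_antisymm h'.1 h'.2)

@[simp] theorem diag_zero : diag (0 : M.C T0) = 0 := natrec_zero

@[simp] theorem diag_add_one (n : M.C T0) :
    diag (n + 1) = diag n + eqInd (tri (diag n + 1)) (n + 1) := natrec_add_one n

theorem tri_mono : Monotone (tri : M.C T0 → M.C T0) := by
  intro m n h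
  obtain ⟨k, rfl⟩ := exists_add_of_le h
  clear h
  induction k using definable_induction with
  | definable => infer_instance
  | zero => rw [add_zero]
  | succ k ih =>
    rw [← add_assoc, tri_add_one]
    exact ih.trans le_self_add

theorem tri_diag_le_and_lt (n : M.C T0) : tri (diag n) ≤ n ∧ n < tri (diag n + 1) := by
  induction n using definable_induction with
  | definable => infer_instance
  | zero => exact ⟨by simp, by rw [diag_zero, tri_add_one]; simp⟩
  | succ n ih =>
    obtain ⟨hle, hlt⟩ := ih
    rw [diag_add_one]
    by_cases h : tri (diag n + 1) = n + 1
    · rw [h, eqInd_self, tri_add_one (diag n + 1), h]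
      exact ⟨le_rfl, lt_add_of_pos_right _ (by simp)⟩
    · rw [eqInd_of_ne h, add_zero]
      exact ⟨hle.trans le_self_add, lt_of_le_of_ne (Order.add_one_le_of_lt hlt) (Ne.symm h)⟩

theorem diag_eq_of_tri {m n : M.C T0} (hle : tri m ≤ n) (hlt : n < tri (m + 1)) : diag n = m := by
  obtain ⟨hle', hlt'⟩ := tri_diag_le_and_lt n
  exact le_antisymm (Order.lt_add_one_iff.1 (tri_mono.reflect_lt (hle'.trans_lt hlt)))
    (Order.lt_add_one_iff.1 (tri_mono.reflect_lt (hle.trans_lt hlt')))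

theorem diag_pair (m n : M.C T0) : diag (pair m n) = m + n := by
  refine diag_eq_of_tri le_self_add ?_
  rw [tri_add_one, pair, add_lt_add_iff_left, Order.lt_add_one_iff]
  exact le_self_add

@[simp] theorem fst_pair (m n : M.C T0) : fst (pair m n) = m := by
  rw [fst, diag_pair, pair, add_tsub_cancel_left]

@[simp] theorem snd_pair (m n : M.C T0) : snd (pair m n) = n := by
  rw [snd, diag_pair, fst_pair, add_tsub_cancel_left]

@[simp] theorem pow2_zero : pow2 (0 : M.C T0) = 1 := natrec_zero

@[simp] theorem pow2_add_one (n : M.C T0) : pow2 (n + 1) = pow2 n + pow2 n := natrec_add_one n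

theorem pow2_add (m n : M.C T0) : pow2 (m + n) = pow2 m * pow2 n := by
  induction n using definable_induction with
  | definable => infer_instance
  | zero => simp
  | succ n ih => rw [← add_assoc, pow2_add_one, ih, pow2_add_one, mul_add]

theorem lt_pow2 (n : M.C T0) : n < pow2 n := by
  induction n using definable_induction with
  | definable => infer_instance
  | zero => simp
  | succ n ih =>
    rw [pow2_add_one]
    exact add_lt_add_of_lt_of_le ih (Order.one_le_iff_pos.2 (zero_le.trans_lt ih))

theorem pow2_pos (n : M.C T0) : 0 < pow2 n := zero_le.trans_lt (lt_pow2 n)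

section EvalPair

variable {ν : M.Val} {ρ : M.Env Γ} {s t : Tm Γ T0}

@[simp] theorem eval_tri : eval ν ρ (HORM.tri t) = tri (eval ν ρ t) := by simp [HORM.tri, tri]

@[simp] theorem eval_eqInd : eval ν ρ (HORM.eqInd s t) = eqInd (eval ν ρ s) (eval ν ρ t) := by
  simp [HORM.eqInd, eqInd]

@[simp] theorem eval_diag : eval ν ρ (HORM.diag t) = diag (eval ν ρ t) := by
  simp [HORM.diag, diag]

@[simp] theorem eval_pair : eval ν ρ (HORM.pair s t) = pair (eval ν ρ s) (eval ν ρ t) := by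
  simp [HORM.pair, pair]

@[simp] theorem eval_fst : eval ν ρ (HORM.fst t) = fst (eval ν ρ t) := by simp [HORM.fst, fst]

@[simp] theorem eval_snd : eval ν ρ (HORM.snd t) = snd (eval ν ρ t) := by simp [HORM.snd, snd]

@[simp] theorem eval_pow2 : eval ν ρ (HORM.pow2 t) = pow2 (eval ν ρ t) := by
  simp [HORM.pow2, pow2]

end EvalPair

end Model

/-! ## The ordered field of fractions of an ordered semiring -/

open scoped TensorProduct

section

variable (R : Type*) [CommSemiring R]

/-- The ring of formal differences of elements of a semiring. -/
abbrev DifferenceRing : Type _ := ℤ ⊗[ℕ] R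

namespace DifferenceRing

variable {R}

/-- The canonical map of the semiring into its ring of differences. -/
noncomputable def of : R →ₐ[ℕ] DifferenceRing R := Algebra.TensorProduct.includeRight

theorem exists_eq_of_sub_of (x : DifferenceRing R) : ∃ a b : R, x = of a - of b := by
  induction x using TensorProduct.induction_on with
  | zero => exact ⟨0, 0, by simp⟩
  | tmul n a =>
    have tmul_eq (m : ℕ) : (m : ℤ) ⊗ₜ a = of (m • a) := by
      rw [map_nsmul, of, Algebra.TensorProduct.includeRight_apply, TensorProduct.smul_tmul',
        nsmul_one]
    obtain ⟨m, rfl | rfl⟩ := n.eq_nat_or_neg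
    · exact ⟨m • a, 0, by rw [tmul_eq, map_zero, sub_zero]⟩
    · exact ⟨0, m • a, by rw [TensorProduct.neg_tmul, tmul_eq, map_zero, zero_sub]⟩
  | add x y hx hy =>
    obtain ⟨a, b, rfl⟩ := hx
    obtain ⟨c, d, rfl⟩ := hy
    exact ⟨a + c, b + d, by simp only [map_add]; ring⟩

-- `n ⊗ a ↦ n • a` maps the ring of differences to the Grothendieck group.
theorem of_injective [IsCancelAdd R] : Function.Injective (of (R := R)) := by
  let φ : ℤ ⊗[ℕ] R →ₗ[ℕ] Algebra.GrothendieckAddGroup R :=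
    TensorProduct.lift <| LinearMap.mk₂ ℕ (fun n a => n • Algebra.GrothendieckAddGroup.of a)
      (fun _ _ _ => add_smul ..) (fun _ _ _ => smul_assoc ..)
      (fun _ _ _ => by rw [map_add, smul_add]) (fun _ _ _ => by rw [map_nsmul, smul_comm])
  have hφ : φ ∘ of = Algebra.GrothendieckAddGroup.of :=
    funext fun _ => (TensorProduct.lift.tmul ..).trans (one_smul ..)
  exact .of_comp (f := φ) (hφ ▸ Algebra.GrothendieckAddGroup.of_injective)

variable [LinearOrder R] [CanonicallyOrderedAdd R]

theorem eq_of_or_eq_neg_of (x : DifferenceRing R) : ∃ a : R, x = of a ∨ x = -of a := by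
  obtain ⟨a, b, rfl⟩ := x.exists_eq_of_sub_of
  rcases le_total a b with h | h
  · obtain ⟨c, rfl⟩ := exists_add_of_le h
    exact ⟨c, .inr (by rw [map_add]; ring)⟩
  · obtain ⟨c, rfl⟩ := exists_add_of_le h
    exact ⟨c, .inl (by rw [map_add]; ring)⟩

variable [IsStrictOrderedRing R]

instance : IsDomain (DifferenceRing R) := by
  have : Nontrivial (DifferenceRing R) := of_injective.nontrivial
  have : NoZeroDivisors (DifferenceRing R) := by
    refine ⟨fun {x y} h => ?_⟩
    obtain ⟨a, ha⟩ := eq_of_or_eq_neg_of x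
    obtain ⟨b, hb⟩ := eq_of_or_eq_neg_of y
    have hab : of (a * b) = 0 := by
      rw [map_mul]
      rcases ha with rfl | rfl <;> rcases hb with rfl | rfl
      · exact h
      · linear_combination -h
      · linear_combination -h
      · linear_combination h
    rw [map_eq_zero_iff _ of_injective, mul_eq_zero] at hab
    refine hab.imp ?_ ?_ <;> rintro rfl
    · simpa using ha
    · simpa using hb
  exact NoZeroDivisors.to_isDomain _

end DifferenceRing

end

section

variable (R : Type*) [CommSemiring R]

/-- The field of fractions of the ring of differences of a semiring. -/
def DifferenceField : Type _ := FractionRing (DifferenceRing R)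

namespace DifferenceField

variable {R}

noncomputable instance : CommRing (DifferenceField R) :=
  inferInstanceAs (CommRing (FractionRing (DifferenceRing R)))

noncomputable instance : Algebra (DifferenceRing R) (DifferenceField R) :=
  inferInstanceAs (Algebra (DifferenceRing R) (FractionRing (DifferenceRing R)))

instance : IsFractionRing (DifferenceRing R) (DifferenceField R) :=
  inferInstanceAs (IsFractionRing (DifferenceRing R) (FractionRing (DifferenceRing R)))

/-- The canonical map of the semiring into the field. -/
noncomputable def of : R →+* DifferenceField R :=
  (algebraMap (DifferenceRing R) (DifferenceField R)).comp DifferenceRing.of.toRingHom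

theorem of_injective [IsCancelAdd R] : Function.Injective (of (R := R)) :=
  (IsFractionRing.injective (DifferenceRing R) (DifferenceField R)).comp
    DifferenceRing.of_injective

variable [LinearOrder R] [CanonicallyOrderedAdd R] [IsStrictOrderedRing R]

noncomputable instance : Field (DifferenceField R) := IsFractionRing.toField (DifferenceRing R)

theorem of_ne_zero {a : R} (h : a ≠ 0) : of a ≠ 0 := (map_ne_zero_iff _ of_injective).2 h

theorem eq_div_or_eq_neg_div (x : DifferenceField R) :
    ∃ a b : R, b ≠ 0 ∧ (x = of a / of b ∨ x = -(of a / of b)) := by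
  obtain ⟨z, w, hw, rfl⟩ := IsFractionRing.div_surjective (A := DifferenceRing R) x
  obtain ⟨a, ha⟩ := z.eq_of_or_eq_neg_of
  obtain ⟨b, hb⟩ := w.eq_of_or_eq_neg_of
  refine ⟨a, b, ?_, ?_⟩
  · rintro rfl
    exact nonZeroDivisors.ne_zero hw (by simpa using hb)
  · rcases ha with rfl | rfl <;> rcases hb with rfl | rfl <;> simp [of, neg_div, div_neg]

/-- The cone of nonnegative fractions. -/
def nonnegCone : RingCone (DifferenceField R) where
  carrier := {x | ∃ a b : R, b ≠ 0 ∧ x = of a / of b}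
  zero_mem' := ⟨0, 1, one_ne_zero, by simp⟩
  one_mem' := ⟨1, 1, one_ne_zero, by simp⟩
  add_mem' := by
    rintro _ _ ⟨a, b, hb, rfl⟩ ⟨c, d, hd, rfl⟩
    refine ⟨a * d + b * c, b * d, mul_ne_zero hb hd, ?_⟩
    rw [div_add_div _ _ (of_ne_zero hb) (of_ne_zero hd)]
    simp
  mul_mem' := by
    rintro _ _ ⟨a, b, hb, rfl⟩ ⟨c, d, hd, rfl⟩
    refine ⟨a * c, b * d, mul_ne_zero hb hd, ?_⟩
    rw [div_mul_div_comm]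
    simp
  eq_zero_of_mem_of_neg_mem' := by
    rintro _ ⟨a, b, hb, rfl⟩ ⟨c, d, hd, h⟩
    have hb' := of_ne_zero hb
    have hd' := of_ne_zero hd
    field_simp at h
    have h : of (a * d + b * c) = 0 := by
      rw [map_add, map_mul, map_mul]
      linear_combination -h
    rw [map_eq_zero_iff _ of_injective, add_eq_zero, mul_eq_zero] at h
    simp [h.1.resolve_right hd]

instance : HasMemOrNegMem (nonnegCone (R := R)) where
  mem_or_neg_mem x := by
    obtain ⟨a, b, hb, h | h⟩ := eq_div_or_eq_neg_div x
    · exact .inl ⟨a, b, hb, h⟩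
    · exact .inr ⟨a, b, hb, by rw [h, neg_neg]⟩

open Classical in
noncomputable instance : LinearOrder (DifferenceField R) := .mkOfAddGroupCone nonnegCone

instance : IsOrderedRing (DifferenceField R) := .mkOfCone nonnegCone

instance : IsStrictOrderedRing (DifferenceField R) := IsOrderedRing.toIsStrictOrderedRing _

theorem nonneg_iff {x : DifferenceField R} : 0 ≤ x ↔ ∃ a b : R, b ≠ 0 ∧ x = of a / of b := by
  change x - 0 ∈ nonnegCone ↔ _
  rw [sub_zero]
  rfl

theorem of_nonneg (a : R) : 0 ≤ of a := nonneg_iff.2 ⟨a, 1, one_ne_zero, by simp⟩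

theorem of_strictMono : StrictMono (of (R := R)) := by
  intro a b h
  obtain ⟨c, hc, rfl⟩ := lt_iff_exists_add.1 h
  rw [map_add, lt_add_iff_pos_right]
  exact lt_of_le_of_ne (of_nonneg c) (of_ne_zero hc.ne').symm

theorem of_le_of {a b : R} : of a ≤ of b ↔ a ≤ b := of_strictMono.le_iff_le

@[simp] theorem of_lt_of {a b : R} : of a < of b ↔ a < b := of_strictMono.lt_iff_lt

end DifferenceField

end

namespace Model

variable {M : Model} {Γ : List FType} {X : Type} [Ctx M X]

open DifferenceField (of)

/-! ## Rational numbers in a model -/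

/-- The code of the rational number `(a - b) / (c + 1)`. -/
noncomputable def mkQ (a b c : M.C T0) : M.C T0 := pair a (pair b c)

instance {f g h : X → M.C T0} [IsDef f] [IsDef g] [IsDef h] :
    IsDef fun x => mkQ (f x) (g x) (h x) := by
  unfold mkQ; infer_instance

/-- The numerator of a rational number is `qPos q - qNeg q`. -/
noncomputable def qPos (q : M.C T0) : M.C T0 := fst q

instance {f : X → M.C T0} [IsDef f] : IsDef fun x => qPos (f x) := by
  unfold qPos; infer_instance

/-- The numerator of a rational number is `qPos q - qNeg q`. -/
noncomputable def qNeg (q : M.C T0) : M.C T0 := fst (snd q)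

instance {f : X → M.C T0} [IsDef f] : IsDef fun x => qNeg (f x) := by
  unfold qNeg; infer_instance

/-- The denominator of a rational number. -/
noncomputable def qDen (q : M.C T0) : M.C T0 := snd (snd q) + 1

instance {f : X → M.C T0} [IsDef f] : IsDef fun x => qDen (f x) := by
  unfold qDen; infer_instance

/-- The code of the sum of two rational numbers. -/
noncomputable def qAdd (p q : M.C T0) : M.C T0 :=
  mkQ (qPos p * qDen q + qPos q * qDen p) (qNeg p * qDen q + qNeg q * qDen p)
    (pred (qDen p * qDen q))

instance {f g : X → M.C T0} [IsDef f] [IsDef g] : IsDef fun x => qAdd (f x) (g x) := by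
  unfold qAdd; infer_instance

/-- The code of the difference of two rational numbers. -/
noncomputable def qSub (p q : M.C T0) : M.C T0 :=
  mkQ (qPos p * qDen q + qNeg q * qDen p) (qNeg p * qDen q + qPos q * qDen p)
    (pred (qDen p * qDen q))

instance {f g : X → M.C T0} [IsDef f] [IsDef g] : IsDef fun x => qSub (f x) (g x) := by
  unfold qSub; infer_instance

/-- The code of the absolute value of a rational number. -/
noncomputable def qAbs (p : M.C T0) : M.C T0 :=
  mkQ ((qPos p - qNeg p) + (qNeg p - qPos p)) 0 (pred (qDen p))

instance {f : X → M.C T0} [IsDef f] : IsDef fun x => qAbs (f x) := by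
  unfold qAbs; infer_instance

/-- The code of the rational number `m / 2^k`. -/
noncomputable def qDyadic (m k : M.C T0) : M.C T0 := mkQ m 0 (pred (pow2 k))

instance {f g : X → M.C T0} [IsDef f] [IsDef g] : IsDef fun x => qDyadic (f x) (g x) := by
  unfold qDyadic; infer_instance

/-- The value of a code of a rational number. -/
noncomputable def qVal (q : M.C T0) : DifferenceField (M.C T0) :=
  (of (qPos q) - of (qNeg q)) / of (qDen q)

/-- `2^{-k}`. -/
noncomputable def eps (k : M.C T0) : DifferenceField (M.C T0) := 1 / of (pow2 k)

theorem qDen_pos (q : M.C T0) : 0 < qDen q := Order.lt_add_one_iff.2 zero_le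

theorem of_pos {a : M.C T0} (h : 0 < a) : 0 < of a := by
  rw [← map_zero (of (R := M.C T0))]
  exact DifferenceField.of_strictMono h

theorem of_qDen_pos (q : M.C T0) : 0 < of (qDen q) := of_pos (qDen_pos q)

theorem of_two : of (2 : M.C T0) = 2 := map_ofNat _ 2

theorem qVal_mkQ (a b c : M.C T0) : qVal (mkQ a b c) = (of a - of b) / of (c + 1) := by
  simp [qVal, mkQ, qPos, qNeg, qDen]

@[simp] theorem qVal_mkQ_zero : qVal (mkQ 0 0 0 : M.C T0) = 0 := by simp [qVal_mkQ]

@[simp] theorem qVal_mkQ_one : qVal (mkQ 1 0 0 : M.C T0) = 1 := by simp [qVal_mkQ]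

@[simp] theorem qVal_qAdd (p q : M.C T0) : qVal (qAdd p q) = qVal p + qVal q := by
  rw [qAdd, qVal_mkQ, pred_add_one_of_pos (mul_pos (qDen_pos p) (qDen_pos q)), qVal, qVal,
    div_add_div _ _ (of_qDen_pos p).ne' (of_qDen_pos q).ne']
  simp only [map_add, map_mul]
  ring

@[simp] theorem qVal_qSub (p q : M.C T0) : qVal (qSub p q) = qVal p - qVal q := by
  rw [qSub, qVal_mkQ, pred_add_one_of_pos (mul_pos (qDen_pos p) (qDen_pos q)), qVal, qVal,
    div_sub_div _ _ (of_qDen_pos p).ne' (of_qDen_pos q).ne']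
  simp only [map_add, map_mul]
  ring

theorem of_sub_add_sub_eq_abs (a b : M.C T0) : of ((a - b) + (b - a)) = |of a - of b| := by
  rcases le_total a b with h | h
  · rw [tsub_eq_zero_of_le h, abs_of_nonpos (sub_nonpos.2 (DifferenceField.of_le_of.2 h))]
    obtain ⟨c, rfl⟩ := exists_add_of_le h
    simp
  · rw [tsub_eq_zero_of_le h, abs_of_nonneg (sub_nonneg.2 (DifferenceField.of_le_of.2 h))]
    obtain ⟨c, rfl⟩ := exists_add_of_le h
    simp

@[simp] theorem qVal_qAbs (p : M.C T0) : qVal (qAbs p) = |qVal p| := by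
  rw [qAbs, qVal_mkQ, pred_add_one_of_pos (qDen_pos p), of_sub_add_sub_eq_abs, map_zero, sub_zero,
    qVal, abs_div, abs_of_pos (of_qDen_pos p)]

@[simp] theorem qVal_qDyadic (m k : M.C T0) : qVal (qDyadic m k) = of m * eps k := by
  rw [qDyadic, qVal_mkQ, pred_add_one_of_pos (pow2_pos k), map_zero, sub_zero, eps, mul_one_div]

theorem qVal_le_iff {p q : M.C T0} : qVal p ≤ qVal q ↔
    qPos p * qDen q + qNeg q * qDen p ≤ qPos q * qDen p + qNeg p * qDen q := by
  rw [qVal, qVal, div_le_div_iff₀ (of_qDen_pos p) (of_qDen_pos q),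
    ← DifferenceField.of_le_of (R := M.C T0)]
  simp only [map_add, map_mul]
  constructor <;> intro h <;> linarith

instance {f g : X → M.C T0} [IsDef f] [IsDef g] : IsDefP fun x => qVal (f x) ≤ qVal (g x) := by
  simp only [qVal_le_iff]; infer_instance

theorem eps_pos (k : M.C T0) : 0 < eps k := div_pos one_pos (of_pos (pow2_pos k))

@[simp] theorem eps_zero : eps (0 : M.C T0) = 1 := by simp [eps]

theorem eps_add (m k : M.C T0) : eps (m + k) = eps m * eps k := by
  rw [eps, eps, eps, pow2_add, map_mul, one_div_mul_one_div]

theorem eps_add_one (k : M.C T0) : eps (k + 1) = eps k / 2 := by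
  rw [eps, eps, pow2_add_one, map_add, ← two_mul, div_div, mul_comm]

theorem eps_add_two (k : M.C T0) : eps (k + 2) = eps k / 4 := by
  rw [← one_add_one_eq_two, ← add_assoc, eps_add_one, eps_add_one]
  ring

theorem eps_le_one (k : M.C T0) : eps k ≤ 1 := by
  rw [eps, div_le_one (of_pos (pow2_pos k)), ← map_one (of (R := M.C T0)),
    DifferenceField.of_le_of]
  exact Order.one_le_iff_pos.2 (pow2_pos k)

theorem eps_anti {k m : M.C T0} (h : k ≤ m) : eps m ≤ eps k := by
  obtain ⟨d, rfl⟩ := exists_add_of_le h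
  rw [eps_add]
  exact mul_le_of_le_one_right (eps_pos k).le (eps_le_one d)

theorem exists_eps_lt {c : DifferenceField (M.C T0)} (hc : 0 < c) : ∃ k, eps k < c := by
  obtain ⟨a, b, hb, rfl⟩ := DifferenceField.nonneg_iff.1 hc.le
  have hb' := of_pos (pos_iff_ne_zero.2 hb)
  have ha : 1 ≤ of a := by
    rw [← map_one (of (R := M.C T0)), DifferenceField.of_le_of, Order.one_le_iff_ne_zero]
    rintro rfl
    simp at hc
  refine ⟨b, ?_⟩
  rw [eps, div_lt_div_iff₀ (of_pos (pow2_pos b)) hb', one_mul]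
  exact (DifferenceField.of_lt_of.2 (lt_pow2 b)).trans_le
    (le_mul_of_one_le_left (of_pos (pow2_pos b)).le ha)

theorem le_of_forall_eps {a b c : DifferenceField (M.C T0)} (hc : 0 < c)
    (h : ∀ k, a ≤ b + c * eps k) : a ≤ b := by
  by_contra! hab
  obtain ⟨k, hk⟩ := exists_eps_lt (div_pos (sub_pos.2 hab) hc)
  rw [lt_div_iff₀ hc] at hk
  linarith [h k]

/-! ## Real numbers in a model -/

/-- The predicate expressed by the formula `HORM.isReal`. -/
def IsReal (x : M.C T1) : Prop :=
  ∀ k i, qVal (qAbs (qSub (x ⊙ k) (x ⊙ (k + i)))) ≤ qVal (qDyadic 1 k)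

/-- Equality of real numbers. -/
def REq (x y : M.C T1) : Prop := ∀ k, qVal (qAbs (qSub (x ⊙ k) (y ⊙ k))) ≤ qVal (qDyadic 2 k)

/-- The order of the real numbers. -/
def RLe (x y : M.C T1) : Prop := ∀ k, qVal (x ⊙ k) ≤ qVal (qAdd (y ⊙ k) (qDyadic 2 k))

/-- `|x - y| < r`. -/
def DistLt (x y r : M.C T1) : Prop :=
  ∃ k, ¬ qVal (r ⊙ k) ≤ qVal (qAdd (qAbs (qSub (x ⊙ (k + 1)) (y ⊙ (k + 1)))) (qDyadic 2 k))

/-- `|x - y| < 2^{-k}`. -/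
def Near (x y : M.C T1) (k : M.C T0) : Prop :=
  ∃ j, ¬ qVal (qDyadic 1 k) ≤ qVal (qAdd (qAbs (qSub (x ⊙ (j + 1)) (y ⊙ (j + 1)))) (qDyadic 2 j))

/-- `x ∈ [0,1]`. -/
def InUnit (x : M.C T1) : Prop :=
  IsReal x ∧ (∀ k, qVal (mkQ 0 0 0) ≤ qVal (qAdd (x ⊙ k) (qDyadic 2 k))) ∧
    ∀ k, qVal (x ⊙ k) ≤ qVal (qAdd (mkQ 1 0 0) (qDyadic 2 k))

instance [HasE2 M] {f : X → M.C T1} [hf : IsDef f] : IsDefP fun x => IsReal (f x) := by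
  have := (hf.fst (σ := T0)).fst (σ := T0)
  unfold IsReal
  infer_instance

instance [HasE2 M] {f : X → M.C T1} [hf : IsDef f] : IsDefP fun x => InUnit (f x) := by
  have := hf.fst (σ := T0)
  unfold InUnit
  infer_instance

instance [HasE2 M] {f g : X → M.C T1} [hf : IsDef f] [hg : IsDef g] :
    IsDefP fun x => REq (f x) (g x) := by
  have := hf.fst (σ := T0)
  have := hg.fst (σ := T0)
  unfold REq
  infer_instance

instance [HasE2 M] {f g : X → M.C T1} {k : X → M.C T0} [hf : IsDef f] [hg : IsDef g]
    [hk : IsDef k] : IsDefP fun x => Near (f x) (g x) (k x) := by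
  have := hf.fst (σ := T0)
  have := hg.fst (σ := T0)
  have := hk.fst (σ := T0)
  unfold Near
  infer_instance

section EvalReal

variable {ν : M.Val} {ρ : M.Env Γ} {p q r : Tm Γ T0} {x y z : Tm Γ T1}

@[simp] theorem eval_mkQ :
    eval ν ρ (HORM.mkQ p q r) = mkQ (eval ν ρ p) (eval ν ρ q) (eval ν ρ r) := by
  simp [HORM.mkQ, mkQ]

@[simp] theorem eval_qPos : eval ν ρ (HORM.qPos q) = qPos (eval ν ρ q) := eval_fst

@[simp] theorem eval_qNeg : eval ν ρ (HORM.qNeg q) = qNeg (eval ν ρ q) := by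
  simp [HORM.qNeg, qNeg]

@[simp] theorem eval_qDen : eval ν ρ (HORM.qDen q) = qDen (eval ν ρ q) := by
  simp [HORM.qDen, qDen]

@[simp] theorem eval_qAdd : eval ν ρ (HORM.qAdd p q) = qAdd (eval ν ρ p) (eval ν ρ q) := by
  simp [HORM.qAdd, qAdd]

@[simp] theorem eval_qSub : eval ν ρ (HORM.qSub p q) = qSub (eval ν ρ p) (eval ν ρ q) := by
  simp [HORM.qSub, qSub]

@[simp] theorem eval_qAbs : eval ν ρ (HORM.qAbs p) = qAbs (eval ν ρ p) := by
  simp [HORM.qAbs, qAbs]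

@[simp] theorem eval_qDyadic :
    eval ν ρ (HORM.qDyadic p q) = qDyadic (eval ν ρ p) (eval ν ρ q) := by
  simp [HORM.qDyadic, qDyadic]

@[simp] theorem eval_ofQ : eval ν ρ (ofQ q) = lam fun _ => eval ν ρ q := by
  simp [ofQ]

@[simp] theorem sat_qLe : Sat ν ρ (qLe p q) ↔ qVal (eval ν ρ p) ≤ qVal (eval ν ρ q) := by
  rw [qVal_le_iff]
  simp [qLe]

@[simp] theorem sat_isReal : Sat ν ρ (isReal x) ↔ IsReal (eval ν ρ x) := by
  simp only [isReal, IsReal, sat_allQ, sat_qLe, eval_qAbs, eval_qSub, eval_qDyadic, eval_app,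
    eval_wk, eval_here, eval_add, eval_one]

@[simp] theorem sat_rEq : Sat ν ρ (rEq x y) ↔ REq (eval ν ρ x) (eval ν ρ y) := by
  simp only [rEq, REq, sat_allQ, sat_qLe, eval_qAbs, eval_qSub, eval_qDyadic, eval_app,
    eval_wk, eval_here, eval_two]

@[simp] theorem sat_rLe : Sat ν ρ (rLe x y) ↔ RLe (eval ν ρ x) (eval ν ρ y) := by
  simp only [rLe, RLe, sat_allQ, sat_qLe, eval_qAdd, eval_qDyadic, eval_app,
    eval_wk, eval_here, eval_two]

@[simp] theorem sat_inUnit : Sat ν ρ (inUnit x) ↔ InUnit (eval ν ρ x) := by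
  simp only [inUnit, sat_and, sat_isReal, sat_rLe, rZero, rOne, eval_ofQ, InUnit, RLe, lam_app,
    eval_mkQ, eval_zero, eval_one, zero_eq]

@[simp] theorem sat_distLt :
    Sat ν ρ (distLt x y z) ↔ DistLt (eval ν ρ x) (eval ν ρ y) (eval ν ρ z) := by
  simp only [distLt, DistLt, rLt, sat_neg, sat_rLe, RLe, rAbs, rSub, eval_lamQ, eval_qAbs,
    eval_qSub, eval_app, eval_wk, eval_here, eval_sc, lam_app, not_forall]

@[simp] theorem sat_near :
    Sat ν ρ (near x y p) ↔ Near (eval ν ρ x) (eval ν ρ y) (eval ν ρ p) := by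
  simp only [near, Near, sat_distLt, DistLt, eval_ofQ, eval_qDyadic, eval_one, lam_app]

end EvalReal

section Real

variable {x y z : M.C T1} {k : M.C T0}

theorem isReal_iff : IsReal x ↔ ∀ k i, |qVal (x ⊙ k) - qVal (x ⊙ (k + i))| ≤ eps k := by
  simp [IsReal]

theorem rEq_iff : REq x y ↔ ∀ k, |qVal (x ⊙ k) - qVal (y ⊙ k)| ≤ 2 * eps k := by
  simp [REq, of_two]

theorem near_iff : Near x y k ↔
    ∃ j, |qVal (x ⊙ (j + 1)) - qVal (y ⊙ (j + 1))| + 2 * eps j < eps k := by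
  simp only [Near, qVal_qAdd, qVal_qAbs, qVal_qSub, qVal_qDyadic, of_two, map_one, one_mul, not_le]

theorem distLt_iff {r : M.C T1} : DistLt x y r ↔
    ∃ j, |qVal (x ⊙ (j + 1)) - qVal (y ⊙ (j + 1))| + 2 * eps j < qVal (r ⊙ j) := by
  simp only [DistLt, qVal_qAdd, qVal_qAbs, qVal_qSub, qVal_qDyadic, of_two, not_le]

theorem inUnit_iff : InUnit x ↔
    IsReal x ∧ (∀ k, 0 ≤ qVal (x ⊙ k) + 2 * eps k) ∧ ∀ k, qVal (x ⊙ k) ≤ 1 + 2 * eps k := by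
  simp [InUnit, of_two]

theorem IsReal.abs_sub_le (hx : IsReal x) (j k : M.C T0) :
    |qVal (x ⊙ j) - qVal (x ⊙ k)| ≤ eps j + eps k := by
  rw [isReal_iff] at hx
  rcases le_total j k with h | h
  · obtain ⟨i, rfl⟩ := exists_add_of_le h
    linarith [hx j i, eps_pos (j + i)]
  · obtain ⟨i, rfl⟩ := exists_add_of_le h
    rw [abs_sub_comm]
    linarith [hx k i, eps_pos (k + i)]

theorem IsReal.abs_sub_le_abs_sub (hx : IsReal x) (hy : IsReal y) (j k : M.C T0) :
    |qVal (x ⊙ k) - qVal (y ⊙ k)| ≤ |qVal (x ⊙ j) - qVal (y ⊙ j)| + 2 * (eps j + eps k) := by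
  have := _root_.abs_sub_le (qVal (x ⊙ k)) (qVal (x ⊙ j)) (qVal (y ⊙ k))
  have := _root_.abs_sub_le (qVal (x ⊙ j)) (qVal (y ⊙ j)) (qVal (y ⊙ k))
  linarith [hx.abs_sub_le k j, hy.abs_sub_le j k]

theorem isReal_of_const {q : M.C T0} (h : ∀ k, x ⊙ k = q) : IsReal x :=
  isReal_iff.2 fun k i => by simpa [h] using (eps_pos k).le

theorem REq.refl (x : M.C T1) : REq x x := rEq_iff.2 fun k => by
  rw [sub_self, abs_zero]
  exact mul_nonneg zero_le_two (eps_pos k).le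

theorem REq.symm (h : REq x y) : REq y x := rEq_iff.2 fun k => by
  rw [abs_sub_comm]
  exact rEq_iff.1 h k

theorem REq.trans (hx : IsReal x) (hz : IsReal z) (h : REq x y) (h' : REq y z) : REq x z := by
  refine rEq_iff.2 fun k => le_of_forall_eps (c := 6) (by norm_num) fun j => ?_
  have := abs_sub_le (qVal (x ⊙ j)) (qVal (y ⊙ j)) (qVal (z ⊙ j))
  linarith [hx.abs_sub_le_abs_sub hz j k, rEq_iff.1 h j, rEq_iff.1 h' j]

theorem Near.mono {i : M.C T0} (h : Near x y k) (hi : i ≤ k) : Near x y i := by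
  rw [near_iff] at h ⊢
  obtain ⟨j, h⟩ := h
  exact ⟨j, h.trans_le (eps_anti hi)⟩

theorem near_of_forall_eq (h : ∀ k, x ⊙ k = y ⊙ k) (k : M.C T0) : Near x y k := by
  refine near_iff.2 ⟨k + 2, ?_⟩
  rw [h, sub_self, abs_zero, eps_add_two]
  linarith [eps_pos k]

theorem Near.congr_right (hx : IsReal x) (hy : IsReal y) (h : Near x y k) (hyz : REq y z) :
    Near x z k := by
  rw [near_iff] at h ⊢
  obtain ⟨j, h⟩ := h
  refine ⟨j + 2 + 1, ?_⟩
  have hxy := hx.abs_sub_le_abs_sub hy (j + 1) (j + 2 + 1 + 1)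
  have hyz := rEq_iff.1 hyz (j + 2 + 1 + 1)
  have := abs_sub_le (qVal (x ⊙ (j + 2 + 1 + 1))) (qVal (y ⊙ (j + 2 + 1 + 1)))
    (qVal (z ⊙ (j + 2 + 1 + 1)))
  simp only [eps_add_one, eps_add_two] at hxy hyz ⊢
  linarith [eps_pos j]

theorem exists_not_near (hx : IsReal x) (hy : IsReal y) (h : ¬ REq x y) : ∃ k, ¬ Near x y k := by
  simp only [rEq_iff, not_forall, not_le] at h
  obtain ⟨k, hk⟩ := h
  obtain ⟨i, hi⟩ := exists_eps_lt (sub_pos.2 hk)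
  refine ⟨i, fun h => ?_⟩
  obtain ⟨j, hj⟩ := near_iff.1 h
  have := hx.abs_sub_le_abs_sub hy (j + 1) k
  rw [eps_add_one] at this
  linarith [eps_pos j]

end Real

/-- The functional `Y` is an injection of `[0,1]` into the numbers of the model. -/
structure IsUnitInjection (Y : M.C T2) : Prop where
  congr {x x' : M.C T1} : InUnit x → InUnit x' → REq x x' → Y ⊙ x = Y ⊙ x'
  injective {x x' : M.C T1} : InUnit x → InUnit x' → Y ⊙ x = Y ⊙ x' → REq x x'

/-! ## Avoiding finitely many shrinking intervals -/

section Avoid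

theorem eps_two_mul_add_one (m : M.C T0) : eps (2 * (m + 1)) = eps (2 * m) / 4 := by
  rw [mul_add, mul_one, eps_add_two]

theorem eps_two_mul_le (k : M.C T0) : eps (2 * k) ≤ eps k := by
  rw [two_mul]
  exact eps_anti le_self_add

variable (Y : M.C T2) (k : M.C T0) (y : M.C (T0 ⇒ T1))

/-- Some `y i` with `i ≤ k` and `Y (y i) = m` is at most the midpoint of the interval
`[u / 4^m, (u + 1) / 4^m]`. -/
def MeetsLeftHalf (u m : M.C T0) : Prop :=
  ∃ i, i ≤ k ∧ Y ⊙ (y ⊙ i) = m ∧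
    ∀ j, qVal (y ⊙ i ⊙ j) ≤ qVal (qAdd (qDyadic (2 * u + 1) (2 * m + 1)) (qDyadic 1 j))

open Classical in
/-- The numerators over `4^m` of the left end points of a nested sequence of intervals of length
`4^{-m}`: each interval is the outer quarter of the preceding one that lies in the half opposite to
the point `y i` with `Y (y i) = m`. -/
noncomputable def avoidNum (m : M.C T0) : M.C T0 :=
  natrec m 0 fun u v => 4 * u + if MeetsLeftHalf Y k y u v then 3 else 0

/-- The real number in the nested intervals. -/
noncomputable def avoid : M.C T1 := lam fun m => qDyadic (avoidNum Y k y m) (2 * m)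

variable {Y k y} {i j m : M.C T0}

theorem MeetsLeftHalf.le_midpoint {u : M.C T0} (hY : IsUnitInjection Y)
    (hy : ∀ i, i ≤ k → InUnit (y ⊙ i)) (hi : i ≤ k)
    (h : MeetsLeftHalf Y k y u (Y ⊙ (y ⊙ i))) (j : M.C T0) :
    qVal (y ⊙ i ⊙ j) ≤ qVal (qDyadic (2 * u + 1) (2 * (Y ⊙ (y ⊙ i)) + 1)) + 3 * eps j := by
  obtain ⟨i', hi', hYi', hle⟩ := h
  have h1 := hle j
  have h2 := abs_le.1 (rEq_iff.1 (hY.injective (hy i' hi') (hy i hi) hYi') j)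
  rw [qVal_qAdd, qVal_qDyadic 1, map_one, one_mul] at h1
  linarith [h2.1]

theorem midpoint_le_of_not_meetsLeftHalf {u : M.C T0} (hy : IsReal (y ⊙ i)) (hi : i ≤ k)
    (h : ¬ MeetsLeftHalf Y k y u (Y ⊙ (y ⊙ i))) (j : M.C T0) :
    qVal (qDyadic (2 * u + 1) (2 * (Y ⊙ (y ⊙ i)) + 1)) ≤ qVal (y ⊙ i ⊙ j) + eps j := by
  obtain ⟨j', hj'⟩ := not_forall.1 fun hle => h ⟨i, hi, rfl, hle⟩
  rw [qVal_qAdd, qVal_qDyadic 1, map_one, one_mul, not_le] at hj'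
  linarith [(abs_le.1 (hy.abs_sub_le j' j)).2]

variable [HasE2 M] (Y k y)

instance : IsDefP fun p : (X × M.C T0) × M.C T0 => MeetsLeftHalf Y k y p.1.2 p.2 := by
  unfold MeetsLeftHalf
  infer_instance

instance : IsDef fun p : M.Pt × M.C T0 => avoidNum Y k y p.2 := by
  unfold avoidNum
  infer_instance

theorem qVal_avoid (m : M.C T0) : qVal (avoid Y k y ⊙ m) = of (avoidNum Y k y m) * eps (2 * m) := by
  rw [avoid, lam_app, qVal_qDyadic]

theorem qVal_avoid_zero : qVal (avoid Y k y ⊙ 0) = 0 := by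
  rw [qVal_avoid, avoidNum, natrec_zero, map_zero, zero_mul]

open Classical in
theorem qVal_avoid_add_one (m : M.C T0) : qVal (avoid Y k y ⊙ (m + 1)) = qVal (avoid Y k y ⊙ m) +
    (if MeetsLeftHalf Y k y (avoidNum Y k y m) m then 3 / 4 else 0) * eps (2 * m) := by
  have : avoidNum Y k y (m + 1) = 4 * avoidNum Y k y m +
      if MeetsLeftHalf Y k y (avoidNum Y k y m) m then 3 else 0 := natrec_add_one m
  have h4 : of (4 : M.C T0) = 4 := map_ofNat _ 4
  have h3 : of (3 : M.C T0) = 3 := map_ofNat _ 3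
  rw [qVal_avoid, qVal_avoid, this, eps_two_mul_add_one, map_add, map_mul, h4]
  split_ifs
  · rw [h3]; ring
  · rw [map_zero]; ring

theorem avoid_nested (m i : M.C T0) : qVal (avoid Y k y ⊙ m) ≤ qVal (avoid Y k y ⊙ (m + i)) ∧
    qVal (avoid Y k y ⊙ (m + i)) + eps (2 * (m + i)) ≤ qVal (avoid Y k y ⊙ m) + eps (2 * m) := by
  have nested : qVal (avoid Y k y ⊙ m) ≤ qVal (avoid Y k y ⊙ (m + i)) ∧
      qVal (qAdd (avoid Y k y ⊙ (m + i)) (qDyadic 1 (2 * (m + i)))) ≤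
        qVal (qAdd (avoid Y k y ⊙ m) (qDyadic 1 (2 * m))) := by
    induction i using definable_induction with
    | definable => infer_instance
    | zero => rw [add_zero]; exact ⟨le_rfl, le_rfl⟩
    | succ i ih =>
      simp only [qVal_qAdd, qVal_qDyadic, map_one, one_mul] at ih ⊢
      rw [← add_assoc, qVal_avoid_add_one, eps_two_mul_add_one]
      have := eps_pos (2 * (m + i))
      split_ifs <;> constructor <;> linarith [ih.1, ih.2]
  simpa only [qVal_qAdd, qVal_qDyadic, map_one, one_mul] using nested

theorem inUnit_avoid : InUnit (avoid Y k y) := by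
  refine inUnit_iff.2 ⟨isReal_iff.2 fun m i => ?_, fun m => ?_, fun m => ?_⟩
  · have h := avoid_nested Y k y m i
    rw [abs_le]
    constructor <;> linarith [eps_pos (2 * (m + i)), eps_two_mul_le m, eps_pos m, h.1, h.2]
  · have h := avoid_nested Y k y 0 m
    rw [qVal_avoid_zero, zero_add] at h
    linarith [h.1, eps_pos m]
  · have h := avoid_nested Y k y 0 m
    rw [qVal_avoid_zero, zero_add, mul_zero, eps_zero] at h
    linarith [h.2, eps_pos m, eps_pos (2 * m)]

theorem qVal_midpoint (m : M.C T0) : qVal (qDyadic (2 * avoidNum Y k y m + 1) (2 * m + 1)) =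
    qVal (avoid Y k y ⊙ m) + eps (2 * m) / 2 := by
  rw [qVal_qDyadic, qVal_avoid, eps_add_one, map_add, map_mul, of_two, map_one]
  ring

variable {Y k y}

theorem three_quarters_le_avoid (h : MeetsLeftHalf Y k y (avoidNum Y k y m) m) (hm : m < j) :
    qVal (avoid Y k y ⊙ m) + 3 / 4 * eps (2 * m) ≤ qVal (avoid Y k y ⊙ j) := by
  obtain ⟨d, rfl⟩ := exists_add_of_le (Order.add_one_le_of_lt hm)
  have := (avoid_nested Y k y (m + 1) d).1
  rwa [qVal_avoid_add_one, if_pos h] at this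

theorem avoid_le_quarter (h : ¬ MeetsLeftHalf Y k y (avoidNum Y k y m) m) (hm : m < j) :
    qVal (avoid Y k y ⊙ j) ≤ qVal (avoid Y k y ⊙ m) + eps (2 * m) / 4 := by
  obtain ⟨d, rfl⟩ := exists_add_of_le (Order.add_one_le_of_lt hm)
  have := (avoid_nested Y k y (m + 1) d).2
  rw [qVal_avoid_add_one, if_neg h, eps_two_mul_add_one m] at this
  linarith [eps_pos (2 * (m + 1 + d))]

theorem eps_le_abs_avoid_sub (hY : IsUnitInjection Y) (hy : ∀ i, i ≤ k → InUnit (y ⊙ i))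
    (hi : i ≤ k) (hj : Y ⊙ (y ⊙ i) < j) : eps (2 * (Y ⊙ (y ⊙ i))) / 4 ≤
      |qVal (avoid Y k y ⊙ j) - qVal (y ⊙ i ⊙ j)| + 3 * eps j := by
  by_cases h : MeetsLeftHalf Y k y (avoidNum Y k y (Y ⊙ (y ⊙ i))) (Y ⊙ (y ⊙ i))
  · have hle := h.le_midpoint hY hy hi j
    rw [qVal_midpoint] at hle
    linarith [three_quarters_le_avoid h hj, le_abs_self (qVal (avoid Y k y ⊙ j) - qVal (y ⊙ i ⊙ j))]
  · have hle := midpoint_le_of_not_meetsLeftHalf (hy i hi).1 hi h j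
    rw [qVal_midpoint] at hle
    linarith [avoid_le_quarter h hj, neg_abs_le (qVal (avoid Y k y ⊙ j) - qVal (y ⊙ i ⊙ j)),
      eps_pos j]

theorem not_distLt_avoid (hY : IsUnitInjection Y) (hy : ∀ i, i ≤ k → InUnit (y ⊙ i))
    (hi : i ≤ k) {r : M.C T1} (hr : ∀ j, qVal (r ⊙ j) = eps (2 * (Y ⊙ (y ⊙ i)) + 2)) :
    ¬ DistLt (avoid Y k y) (y ⊙ i) r := by
  rw [distLt_iff]
  rintro ⟨j, hj⟩
  rw [hr] at hj
  have hlt : 2 * (Y ⊙ (y ⊙ i)) + 2 < j := by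
    by_contra! h
    linarith [abs_nonneg (qVal (avoid Y k y ⊙ (j + 1)) - qVal (y ⊙ i ⊙ (j + 1))), eps_anti h,
      eps_pos j]
  have hle : Y ⊙ (y ⊙ i) ≤ 2 * (Y ⊙ (y ⊙ i)) + 2 := by
    rw [two_mul, add_assoc]
    exact le_self_add
  have := eps_le_abs_avoid_sub hY hy hi (Order.lt_add_one_iff.2 (hle.trans hlt.le))
  rw [eps_add_one] at this
  rw [eps_add_two] at hj
  linarith [eps_pos j]

end Avoid

/-! ## Coding real numbers by elements of Cantor space -/

section Coding

/-- The rational number `q` approximates the real number `x` up to `2^{-k-2}`. -/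
def Approx (x : M.C T1) (q k : M.C T0) : Prop :=
  ∀ j, qVal (qAbs (qSub (x ⊙ j) q)) ≤ qVal (qAdd (qDyadic 1 (k + 2)) (qDyadic 1 j))

open Classical in
/-- The real number `x` as an element of Cantor space: the set, with `0` for membership, of the
pairs of a rational number and a precision to which it approximates `x`. Equal reals have the same
set of approximations, so that the code does not depend on the Cauchy sequence. -/
noncomputable def encode (x : M.C T1) : M.C T1 :=
  lam fun p => if Approx x (fst p) (snd p) then 0 else 1

/-- The real number with the set of approximations `f`, for a search operator `F`. -/
noncomputable def decode (F : M.C T2) (f : M.C T1) : M.C T1 :=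
  lam fun k => F ⊙ lam fun v => f ⊙ pair v k

/-- The function `f` is the code of an element of `[0,1]`. -/
def IsCode (F : M.C T2) (f : M.C T1) : Prop :=
  InUnit (decode F f) ∧ ∀ p, f ⊙ p = encode (decode F f) ⊙ p

variable {x x' f g : M.C T1} {F : M.C T2} {q k : M.C T0}

theorem approx_iff : Approx x q k ↔ ∀ j, |qVal (x ⊙ j) - qVal q| ≤ eps (k + 2) + eps j := by
  simp only [Approx, qVal_qAbs, qVal_qSub, qVal_qAdd, qVal_qDyadic, map_one, one_mul]

theorem Approx.congr (hx' : IsReal x') (h : REq x x') (ha : Approx x q k) : Approx x' q k := by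
  rw [approx_iff] at ha ⊢
  refine fun j => le_of_forall_eps (c := 4) (by norm_num) fun i => ?_
  have hj := abs_le.1 (hx'.abs_sub_le j i)
  have hi := abs_le.1 (rEq_iff.1 h i)
  have hq := abs_le.1 (ha i)
  rw [abs_le]
  constructor <;> linarith [hj.1, hj.2, hi.1, hi.2, hq.1, hq.2]

theorem IsCode.eq_encode (hf : IsCode F f) : f = encode (decode F f) := M.app_ext _ _ hf.2

instance {f : X → M.C T1} [hf : IsDef f] : IsDef fun x => decode F (f x) := by
  have := (hf.fst (σ := T0)).fst (σ := T0)
  unfold decode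
  infer_instance

variable [HasE2 M]

instance {f : X → M.C T1} [hf : IsDef f] : IsDef fun x => encode (f x) := by
  have := (hf.fst (σ := T0)).fst (σ := T0)
  have := hf.fst (σ := T0)
  unfold encode Approx
  infer_instance

instance {f : X → M.C T1} [hf : IsDef f] : IsDefP fun x => IsCode F (f x) := by
  have := hf.fst (σ := T0)
  unfold IsCode
  infer_instance

open Classical in
theorem encode_app (p : M.C T0) :
    encode x ⊙ p = if Approx x (fst p) (snd p) then 0 else 1 := by
  have : IsDefP fun p : M.Pt × M.C T0 => Approx x (fst p.2) (snd p.2) := by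
    unfold Approx
    infer_instance
  rw [encode, lam_app]

theorem encode_le_one (p : M.C T0) : encode x ⊙ p ≤ 1 := by
  rw [encode_app]
  split_ifs
  exacts [zero_le, le_rfl]

theorem encode_congr (hx : IsReal x) (hx' : IsReal x') (h : REq x x') : encode x = encode x' := by
  refine M.app_ext _ _ fun p => ?_
  rw [encode_app, encode_app]
  congr 1
  exact propext ⟨.congr hx' h, .congr hx h.symm⟩

theorem IsCode.eq_of_rEq (hf : IsCode F f) (hg : IsCode F g) (h : REq (decode F f) (decode F g)) :
    f = g := by
  rw [hf.eq_encode, hg.eq_encode]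
  exact encode_congr hf.1.1 hg.1.1 h

theorem approx_decode_encode (hF : IsSearch F) (hx : IsReal x) (k : M.C T0) :
    Approx x (decode F (encode x) ⊙ k) k := by
  have approx_of_eq_zero {v} (hv : encode x ⊙ pair v k = 0) : Approx x v k := by
    rw [encode_app, fst_pair, snd_pair] at hv
    by_contra hc
    rw [if_neg hc] at hv
    exact one_ne_zero hv
  have approx_value : Approx x (x ⊙ (k + 2)) k :=
    approx_iff.2 fun j => (hx.abs_sub_le j (k + 2)).trans_eq (add_comm _ _)
  rw [decode, lam_app]
  refine approx_of_eq_zero ?_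
  have := hF (lam fun v => encode x ⊙ pair v k)
  simp only [lam_app] at this
  exact this ⟨x ⊙ (k + 2), by rw [encode_app, fst_pair, snd_pair, if_pos approx_value]⟩

theorem isReal_decode_encode (hF : IsSearch F) (hx : IsReal x) :
    IsReal (decode F (encode x)) := by
  refine isReal_iff.2 fun k i => ?_
  have hk := abs_le.1 (approx_iff.1 (approx_decode_encode hF hx k) (k + 2))
  have hki := abs_le.1 (approx_iff.1 (approx_decode_encode hF hx (k + i)) (k + 2))
  have hle : eps (k + i) ≤ eps k := eps_anti le_self_add
  rw [eps_add_two] at hk hki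
  rw [eps_add_two] at hki
  rw [abs_le]
  constructor <;> linarith [hk.1, hk.2, hki.1, hki.2]

theorem rEq_decode_encode (hF : IsSearch F) (hx : IsReal x) : REq x (decode F (encode x)) := by
  refine rEq_iff.2 fun k => ?_
  have h := approx_iff.1 (approx_decode_encode hF hx k) k
  rw [eps_add_two] at h
  linarith [eps_pos k]

theorem inUnit_decode_encode (hF : IsSearch F) (hx : InUnit x) : InUnit (decode F (encode x)) := by
  obtain ⟨hr, h0, h1⟩ := inUnit_iff.1 hx
  refine inUnit_iff.2 ⟨isReal_decode_encode hF hr, fun k => ?_, fun k => ?_⟩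
  all_goals
    have h := abs_le.1 (approx_iff.1 (approx_decode_encode hF hr k) (k + 2))
    have hx0 := h0 (k + 2)
    have hx1 := h1 (k + 2)
    rw [eps_add_two] at h hx0 hx1
    linarith [h.1, h.2, eps_pos k]

theorem isCode_encode (hF : IsSearch F) (hx : InUnit x) : IsCode F (encode x) :=
  ⟨inUnit_decode_encode hF hx, fun p => congrArg (· ⊙ p) <|
    encode_congr hx.1 (isReal_decode_encode hF hx.1) (rEq_decode_encode hF hx.1)⟩

end Coding

/-! ## Listing the points with small values -/

/-- The function `f` is an element of Cantor space. -/
def InCantor (f : M.C T1) : Prop := ∀ i, f ⊙ i ≤ 1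

/-- The principle `IND₀` in the model `M`. -/
def HasInd (M : Model) : Prop :=
  ∀ Z : M.C (T1 ⇒ T0 ⇒ T0),
    (∀ n f g, InCantor f → InCantor g → Z ⊙ f ⊙ n = 0 → Z ⊙ g ⊙ n = 0 → f = g) →
    ∀ k, ∃ l, ∃ w : M.C (T0 ⇒ T1), ∀ m, m ≤ k →
      ((∃ i, i < l ∧ InCantor (w ⊙ i) ∧ Z ⊙ (w ⊙ i) ⊙ m = 0) ↔
        ∃ f, InCantor f ∧ Z ⊙ f ⊙ m = 0)

section Listing

variable [HasE2 M] {Y : M.C T2}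

theorem IsUnitInjection.exists_enumeration (hY : IsUnitInjection Y) (hM : HasInd M)
    (n : M.C T0) : ∃ l, ∃ z : M.C (T0 ⇒ T1), ∀ x, InUnit x → Y ⊙ x ≤ n →
      ∃ i, i < l ∧ InUnit (z ⊙ i) ∧ REq (z ⊙ i) x := by
  classical
  obtain ⟨F, hF⟩ := exists_isSearch (M := M)
  let Z : M.C (T1 ⇒ T0 ⇒ T0) := lam fun f => lam fun m =>
    if IsCode F f ∧ Y ⊙ decode F f = m then 0 else 1
  have hZ (f m) : Z ⊙ f ⊙ m = 0 ↔ IsCode F f ∧ Y ⊙ decode F f = m := by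
    simp only [Z, lam_app]
    split_ifs with h
    · exact iff_of_true rfl h
    · exact iff_of_false one_ne_zero h
  have Z_injective (m f g) (_ : InCantor f) (_ : InCantor g) (hf : Z ⊙ f ⊙ m = 0)
      (hg : Z ⊙ g ⊙ m = 0) : f = g := by
    rw [hZ] at hf hg
    exact hf.1.eq_of_rEq hg.1 (hY.injective hf.1.1 hg.1.1 (hf.2.trans hg.2.symm))
  obtain ⟨l, w, hw⟩ := hM Z Z_injective n
  refine ⟨l, lam fun i => decode F (w ⊙ i), fun x hx hxn => ?_⟩
  have hc := isCode_encode hF hx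
  have hcx := hY.congr hc.1 hx (rEq_decode_encode hF hx.1).symm
  obtain ⟨i, hi, -, h⟩ := (hw _ hxn).2 ⟨encode x, encode_le_one, (hZ _ _).2 ⟨hc, hcx⟩⟩
  obtain ⟨hwi, hYi⟩ := (hZ _ _).1 h
  refine ⟨i, hi, ?_⟩
  rw [lam_app]
  exact ⟨hwi.1, hY.injective hwi.1 hx hYi⟩

theorem exists_forall_lt_not_near {x : M.C T1} (hx : IsReal x) (z : M.C (T0 ⇒ T1)) (l : M.C T0) :
    ∃ K, ∀ i, i < l → IsReal (z ⊙ i) → ¬ REq x (z ⊙ i) → ¬ Near x (z ⊙ i) K := by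
  induction l using definable_induction with
  | definable => infer_instance
  | zero => exact ⟨0, fun i hi => (not_lt.2 zero_le hi).elim⟩
  | succ l ih =>
    obtain ⟨K, hK⟩ := ih
    by_cases h : IsReal (z ⊙ l) ∧ ¬ REq x (z ⊙ l)
    · obtain ⟨K', hK'⟩ := exists_not_near hx h.1 h.2
      refine ⟨K + K', fun i hi hr he hn => ?_⟩
      rcases (Order.lt_add_one_iff.1 hi).lt_or_eq with hi | rfl
      · exact hK i hi hr he (hn.mono le_self_add)
      · exact hK' (hn.mono le_add_self)
    · refine ⟨K, fun i hi hr he => ?_⟩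
      rcases (Order.lt_add_one_iff.1 hi).lt_or_eq with hi | rfl
      · exact hK i hi hr he
      · exact (h ⟨hr, he⟩).elim

-- The finitely many points with values up to `n` have a positive distance from any other point, so
-- every other point of `P` close enough to a given one does.
theorem IsUnitInjection.exists_forall_near_le (hY : IsUnitInjection Y) (hM : HasInd M)
    (n : M.C T0) {P : M.C T1 → Prop} (hP : ∀ x, P x → InUnit x) (hne : ∃ x, P x)
    (hiso : ∀ x, P x → ∀ k, ∃ x', P x' ∧ ¬ REq x x' ∧ Near x x' k) :
    ∃ x, P x ∧ n ≤ Y ⊙ x ∧ ∃ K, ∀ x', P x' → Near x x' K → n ≤ Y ⊙ x' := by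
  obtain ⟨l, z, hz⟩ := hY.exists_enumeration hM n
  obtain ⟨x₀, hx₀⟩ := hne
  have hr₀ := (hP _ hx₀).1
  obtain ⟨K₀, hK₀⟩ := exists_forall_lt_not_near hr₀ z l
  obtain ⟨x, hx, hne, hnear⟩ := hiso x₀ hx₀ K₀
  have hr := (hP _ hx).1
  have not_listed (i) (hi : i < l) (hzi : InUnit (z ⊙ i)) : ¬ REq x (z ⊙ i) := fun h =>
    hK₀ i hi hzi.1 (fun h' => hne (h'.trans hr₀ hr h.symm)) (hnear.congr_right hr₀ hr h)
  obtain ⟨K, hK⟩ := exists_forall_lt_not_near hr z l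
  refine ⟨x, hx, ?_, K, fun x' hx' hn => ?_⟩
  · by_contra! h
    obtain ⟨i, hi, hzi, he⟩ := hz x (hP _ hx) h.le
    exact not_listed i hi hzi he.symm
  · by_contra! h
    obtain ⟨i, hi, hzi, he⟩ := hz x' (hP _ hx') h.le
    exact hK i hi hzi.1 (not_listed i hi hzi) (hn.congr_right hr (hP _ hx').1 he.symm)

end Listing

/-! ## The gauge of an injection -/

theorem hasE2_of_sat {ν : M.Val} (h : Sat ν M.nilEnv existsTwo) : HasE2 M := by
  simp only [existsTwo, sat_exQ, sat_and, sat_allQ, sat_iff, sat_eq, eval_app, eval_wk, eval_here,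
    eval_zero, zero_eq] at h
  obtain ⟨φ, -, h⟩ := h
  exact ⟨φ, h⟩

theorem hasInd_of_sat {ν : M.Val} (h : Sat ν M.nilEnv indZero) : HasInd M := by
  simp only [indZero, sat_exQ, sat_and, sat_allQ, sat_imp, sat_iff, sat_eq, sat_eqT, sat_leN,
    sat_ltN, inCantor, eval_app, eval_wk, eval_here, eval_zero, eval_one, zero_eq] at h
  exact h

/-- The gauge `x ↦ 4^{-Y(x)-1}`. -/
noncomputable def gauge (Y : M.C T2) : M.C (T1 ⇒ T1) :=
  lam fun x => lam fun _ => qDyadic 1 (2 * (Y ⊙ x) + 2)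

open Classical in
/-- The gauge of `Y` truncated at `n`, as a sequence of functionals in `n`. -/
noncomputable def truncGauge (Y : M.C T2) : M.C (T0 ⇒ T1 ⇒ T1) :=
  lam fun n => lam fun x => lam fun _ => qDyadic 1 (2 * (if Y ⊙ x ≤ n then Y ⊙ x else n) + 2)

variable {ν : M.Val} {ρ : M.Env Γ} {Y : M.C T2}

theorem gauge_app (x : M.C T1) (k : M.C T0) :
    gauge Y ⊙ x ⊙ k = qDyadic 1 (2 * (Y ⊙ x) + 2) := by
  simp only [gauge, lam_app]

theorem truncGauge_app (n : M.C T0) (x : M.C T1) (k : M.C T0) :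
    truncGauge Y ⊙ n ⊙ x ⊙ k = qDyadic 1 (2 * min (Y ⊙ x) n + 2) := by
  simp only [truncGauge, lam_app, min_def]

theorem sat_isFunUnitReal_of_const {g : Tm Γ (T1 ⇒ T1)} {q : M.C T1 → M.C T0}
    (hg : ∀ x k, eval ν ρ g ⊙ x ⊙ k = q x)
    (hq : ∀ x x', InUnit x → InUnit x' → REq x x' → q x = q x') : Sat ν ρ (isFunUnitReal g) := by
  simp only [isFunUnitReal, sat_and, sat_allQ, sat_imp, sat_isReal, sat_rEq, sat_inUnit, eval_app,
    eval_wk, eval_here]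
  refine ⟨fun x _ => isReal_of_const (hg x), fun x x' hx hx' h => ?_⟩
  have : eval ν ρ g ⊙ x = eval ν ρ g ⊙ x' := M.app_ext _ _ fun k => by
    rw [hg, hg, hq x x' hx hx' h]
  exact this ▸ REq.refl _

theorem not_rLe_gauge_zero (x : M.C T1) : ¬ RLe (gauge Y ⊙ x) (lam fun _ => mkQ 0 0 0) := by
  intro hle
  have := hle (2 * (Y ⊙ x) + 2 + 2)
  rw [lam_app, gauge_app, qVal_qAdd, qVal_mkQ_zero, qVal_qDyadic, qVal_qDyadic, of_two, map_one,
    eps_add_two (2 * (Y ⊙ x) + 2)] at this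
  linarith [eps_pos (2 * (Y ⊙ x) + 2)]

variable [HasE2 M]

theorem sat_isB2_gauge (hM : HasInd M) (hY : IsUnitInjection Y) {g : Tm Γ (T1 ⇒ T1)}
    (hg : eval ν ρ g = gauge Y) : Sat ν ρ (isB2 g) := by
  simp only [isB2, isLimit, isPerfectInUnit, continuousOnAt, mem, sat_exQ, sat_and, sat_allQ,
    sat_imp, sat_neg, sat_eq, sat_leN, sat_isReal, sat_rEq, sat_inUnit, sat_near, eval_app, eval_wk,
    eval_here, eval_one, hg]
  refine ⟨?_, truncGauge Y, fun n => ?_, fun x _ k => ⟨Y ⊙ x, fun n hn => ?_⟩,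
    fun n P ⟨_, hu, hne, _, hiso⟩ => ?_⟩
  · refine sat_isFunUnitReal_of_const (q := fun x => qDyadic 1 (2 * (Y ⊙ x) + 2))
      (fun x k => ?_) fun x x' hx hx' h => ?_
    · rw [hg, gauge_app]
    · simp only [hY.congr hx hx' h]
  · refine sat_isFunUnitReal_of_const (q := fun x => qDyadic 1 (2 * min (Y ⊙ x) n + 2))
      (fun x k => ?_) fun x x' hx hx' h => ?_
    · simp only [eval_app, eval_wk, eval_here, truncGauge_app]
    · simp only [hY.congr hx hx' h]
  · refine near_of_forall_eq (fun j => ?_) k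
    rw [truncGauge_app, gauge_app, min_eq_left hn]
  · obtain ⟨x, hx, hxn, K, hK⟩ := hY.exists_forall_near_le hM n
      (P := fun x => IsReal x ∧ P ⊙ x = 1) hu hne hiso
    refine ⟨x, hx, fun k => ⟨K, fun y hy hxy => near_of_forall_eq (fun j => ?_) k⟩⟩
    rw [truncGauge_app, truncGauge_app, min_eq_right hxn, min_eq_right (hK y hy hxy)]

theorem sat_HBUB2_imp_NIN (hM : HasInd M) (ν : M.Val) : Sat ν M.nilEnv (HBUB2 ⟶ NIN) := by
  intro h
  simp only [NIN, isFunUnitNat, sat_neg, sat_exQ, sat_and, sat_allQ, sat_imp, sat_eq, sat_rEq,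
    sat_inUnit, eval_app, eval_wk, eval_here]
  rintro ⟨Y, congr, injective⟩
  have hY : IsUnitInjection Y := ⟨congr _ _, injective _ _⟩
  simp only [HBUB2, sat_exQ, sat_and, sat_allQ, sat_imp, sat_leN, sat_inUnit, sat_distLt, rLt,
    sat_neg, sat_rLe, rZero, eval_ofQ, eval_mkQ, eval_zero, zero_eq, eval_app, eval_wk,
    eval_here] at h
  obtain ⟨k, y, hy, hcov⟩ := h (gauge Y) (sat_isB2_gauge hM hY rfl) fun x _ => not_rLe_gauge_zero x
  obtain ⟨i, hi, hd⟩ := hcov _ (inUnit_avoid Y k y)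
  refine not_distLt_avoid hY hy hi (fun j => ?_) hd
  rw [gauge_app, qVal_qDyadic, map_one, one_mul]

end Model

end HORM

/-- The system `ACA₀^ω + IND₀` proves that `HBU` restricted to `B2` implies `NIN`. -/
theorem mainTheorem8 :
    HORM.Proves HORM.ACA0omegaIND0 [] (HORM.Fm.imp HORM.HBUB2 HORM.NIN) := by
  refine HORM.proves_of_forall_sat (fun φ h => .inl h) fun M ν hM => ?_
  have : M.HasE2 := HORM.Model.hasE2_of_sat (hM _ (.inr (.inl rfl)))
  have hInd : M.HasInd := HORM.Model.hasInd_of_sat (hM _ (.inr (.inr rfl)))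
  exact HORM.Model.sat_HBUB2_imp_NIN hInd ν
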